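/- Let $(M^n,g)$ be a smooth $n$-dimensional Riemannian manifold (Hausdorff, second countable, without boundary) with volume measure $dv_g$ and gradient $\nabla$, let $u\in C^\infty(M)$, $V=e^u$, let $\lambda,\mu\in\mathbb{R}$ and $\tau=(n+1)\lambda+\mu$. For the affine connection $D=D^{\lambda,\mu}$, $D_XY=\nabla_XY+\lambda\,du(X)Y+\lambda\,du(Y)X+\mu\, g(X,Y)\nabla u$, the affine gradient and the affine Laplacian are defined by $$\nabla^D f=V^{\mu-\lambda}\nabla f,\qquad \Delta^D f=V^{\mu-\lambda}\big[\Delta f+(2\mu+n\lambda)\langle\nabla u,\nabla f\rangle\big].$$ Let $\rho\ge 0$ be a continuous function on $M$ which has a locally integrable weak gradient $\nabla\rho$ with $|\nabla^D\rho|=1$ almost everywhere. For a function $h$ on $M\setminus\rho^{-1}\{0\}$, the inequality $\Delta^D\rho\le h$ (respectively $\ge h$) in the sense of distributions on $M\setminus\rho^{-1}\{0\}$ means that for every $0\le\eta\in C_0^\infty(M\setminus\rho^{-1}\{0\})$ $$-\int_M\langle\nabla\rho,\nabla(V^{\mu-\lambda}\eta)\rangle\,dv_g+(2\mu+n\lambda)\int_M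 V^{\mu-\lambda}\langle\nabla u,\nabla\rho\rangle\,\eta\,dv_g\ \le\ \int_M h\,\eta\,dv_g\qquad(\text{respectively }\ge).$$ Let $\alpha\in\mathbb{R}$ and $C>0$. (i) If $\Delta^D\rho\le\frac{C}{\rho}V^{\lambda-\mu}$ in the sense of distributions on $M\setminus\rho^{-1}\{0\}$ and $1-\alpha-C>0$, then for every $\varphi\in C_0^\infty(M\setminus\rho^{-1}\{0\})$ $$\int_M\rho^\alpha|\nabla^D\varphi|^2V^{\tau+\lambda-\mu}\,dv_g\ \ge\ \Big(\frac{1-\alpha-C}{2}\Big)^2\int_M\rho^{\alpha-2}\varphi^2V^{\tau+\lambda-\mu}\,dv_g .$$ (ii) If $\Delta^D\rho\ge\frac{C}{\rho}V^{\lambda-\mu}$ in the sense of distributions on $M\setminus\rho^{-1}\{0\}$ and $C+\alpha-1>0$, then for every $\varphi\in C_0^\infty(M\setminus\rho^{-1}\{0\})$ $$\int_M\rho^\alpha|\nabla^D\varphi|^2V^{\tau+\lambda-\mu}\,dv_g\ \ge\ \Big(\frac{\alpha+C-1}{2}\Big)^2\int_M\rho^{\alpha-2}\varphi^2V^{\tau+\lambda-\mu}\,dv_g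 .$$ -/

import Mathlib

open MeasureTheory Set Bundle
open scoped Manifold ContDiff Topology

noncomputable section

namespace AffineHardy

section Calculus

variable {n : ℕ} {M : Type*} [TopologicalSpace M] [ChartedSpace (EuclideanSpace ℝ (Fin n)) M]

/-- The tangent vector at the point `x = e.symm y` of `M` which is represented by `w` in the
preferred chart `e` around `p`, that is, the derivative of `e.symm` at `y` applied to `w`. -/
def chartVector (p : M) (y w : EuclideanSpace ℝ (Fin n)) :
    TangentSpace (𝓡 n) ((chartAt (EuclideanSpace ℝ (Fin n)) p).symm y) :=
  mfderiv (𝓡 n) (𝓡 n) (chartAt (EuclideanSpace ℝ (Fin n)) p).symm y w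

variable [RiemannianBundle (fun x : M => TangentSpace (𝓡 n) x)]

/-- The Gram matrix `g_ij` of the Riemannian metric in the preferred chart around `p`, as a
function on the target of the chart. -/
def gramMatrix (p : M) (y : EuclideanSpace ℝ (Fin n)) : Matrix (Fin n) (Fin n) ℝ :=
  fun i j => inner ℝ (chartVector p y (EuclideanSpace.single i 1))
    (chartVector p y (EuclideanSpace.single j 1))

/-- The Riemannian volume of the domain of the preferred chart around `p`: the image under the
inverse chart of the measure `√(det g_ij) dy`. -/
def chartVolume [MeasurableSpace M] (p : M) : Measure M :=
  ((volume.restrict (chartAt (EuclideanSpace ℝ (Fin n)) p).target).withDensity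
    (fun y => ENNReal.ofReal (Real.sqrt (gramMatrix p y).det))).map
    (chartAt (EuclideanSpace ℝ (Fin n)) p).symm

/-- The Riemannian volume measure `dv_g`. The measures `chartVolume p` agree on the overlaps of
the chart domains, so their supremum in the lattice of measures is the measure on `M` which is
given by `√(det g_ij) dy` in every chart. -/
def riemannianVolume (n : ℕ) (M : Type*) [TopologicalSpace M]
    [ChartedSpace (EuclideanSpace ℝ (Fin n)) M]
    [RiemannianBundle (fun x : M => TangentSpace (𝓡 n) x)] [MeasurableSpace M] : Measure M :=
  ⨆ p : M, chartVolume (n := n) p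

instance tangentSpace_finiteDimensional (x : M) : FiniteDimensional ℝ (TangentSpace (𝓡 n) x) :=
  inferInstanceAs (FiniteDimensional ℝ (EuclideanSpace ℝ (Fin n)))

instance tangentSpace_completeSpace (x : M) : CompleteSpace (TangentSpace (𝓡 n) x) :=
  FiniteDimensional.complete ℝ _

/-- The Riemannian gradient `∇f`: the vector field with `⟨∇f, v⟩ = df(v)`. -/
def grad (f : M → ℝ) (x : M) : TangentSpace (𝓡 n) x :=
  (InnerProductSpace.toDual ℝ (TangentSpace (𝓡 n) x)).symm (mvfderiv (𝓡 n) f x)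

/-- The vector field `G` is the weak (distributional) gradient of `f`: in every preferred chart,
with domain `U` in `ℝⁿ`, and for every coordinate direction `w`, the function `⟨G, w⟩` is locally
integrable on `U` and is the weak derivative of `f` in the direction `w`. -/
def IsWeakGradient (f : M → ℝ) (G : ∀ x : M, TangentSpace (𝓡 n) x) : Prop :=
  ∀ (p : M) (w : EuclideanSpace ℝ (Fin n)),
    LocallyIntegrableOn
      (fun y => inner ℝ (G ((chartAt (EuclideanSpace ℝ (Fin n)) p).symm y)) (chartVector p y w))
      (chartAt (EuclideanSpace ℝ (Fin n)) p).target ∧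
    ∀ ξ : EuclideanSpace ℝ (Fin n) → ℝ, ContDiff ℝ ∞ ξ → HasCompactSupport ξ →
      tsupport ξ ⊆ (chartAt (EuclideanSpace ℝ (Fin n)) p).target →
      ∫ y, f ((chartAt (EuclideanSpace ℝ (Fin n)) p).symm y) * fderiv ℝ ξ y w =
        - ∫ y, inner ℝ (G ((chartAt (EuclideanSpace ℝ (Fin n)) p).symm y)) (chartVector p y w)
          * ξ y

end Calculus

section Affine

variable {n : ℕ} {M : Type*} [TopologicalSpace M] [ChartedSpace (EuclideanSpace ℝ (Fin n)) M]

/-- The weight `V = e^u` of the Riemannian triple `(M, g, V)`. -/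
def weight (u : M → ℝ) (x : M) : ℝ := Real.exp (u x)

/-- The affine gradient for `D^{λ,μ}`: it is `∇^D f = V^(μ-λ) ∇f`, where `G = ∇f` is the
gradient of `f` (classical or weak). -/
def affineGrad (u : M → ℝ) (lam mu : ℝ) (G : ∀ x : M, TangentSpace (𝓡 n) x) (x : M) :
    TangentSpace (𝓡 n) x :=
  weight u x ^ (mu - lam) • G x

variable [RiemannianBundle (fun x : M => TangentSpace (𝓡 n) x)] [MeasurableSpace M]

/-- The value on the test function `η` of the distributional affine Laplacian
`Δ^D f = V^(μ-λ) (Δf + (2μ + nλ) ⟨∇u, ∇f⟩)` of a function `f` with weak gradient `G`. Distributions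
are paired with test functions through `dv_g`; in particular
`⟨Δf, ζ⟩ = - ∫ ⟨∇f, ∇ζ⟩ dv_g` and `⟨V^(μ-λ) Δf, η⟩ = ⟨Δf, V^(μ-λ) η⟩`. -/
def affineLaplacianPairing (u : M → ℝ) (lam mu : ℝ) (G : ∀ x : M, TangentSpace (𝓡 n) x)
    (η : M → ℝ) : ℝ :=
  (- ∫ x, inner ℝ (G x) (grad (fun z => weight u z ^ (mu - lam) * η z) x) ∂riemannianVolume n M) +
    ∫ x, weight u x ^ (mu - lam) * ((2 * mu + n * lam) * inner ℝ (grad u x) (G x)) * η x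
      ∂riemannianVolume n M

/-- `η` belongs to `C_0^∞(Ω)`: it is smooth, and its support is a compact subset of `Ω`. -/
def IsTestFunction (Ω : Set M) (η : M → ℝ) : Prop :=
  ContMDiff (𝓡 n) 𝓘(ℝ, ℝ) ∞ η ∧ HasCompactSupport η ∧ tsupport η ⊆ Ω

/-- `Δ^D f ≤ h` on `Ω` in the sense of distributions, where `f` has weak gradient `G`. -/
def AffineLaplacianLE (u : M → ℝ) (lam mu : ℝ) (G : ∀ x : M, TangentSpace (𝓡 n) x)
    (Ω : Set M) (h : M → ℝ) : Prop :=
  ∀ η : M → ℝ, IsTestFunction (n := n) Ω η → (∀ x, 0 ≤ η x) →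
    affineLaplacianPairing u lam mu G η ≤ ∫ x, h x * η x ∂riemannianVolume n M

/-- `Δ^D f ≥ h` on `Ω` in the sense of distributions, where `f` has weak gradient `G`. -/
def AffineLaplacianGE (u : M → ℝ) (lam mu : ℝ) (G : ∀ x : M, TangentSpace (𝓡 n) x)
    (Ω : Set M) (h : M → ℝ) : Prop :=
  ∀ η : M → ℝ, IsTestFunction (n := n) Ω η → (∀ x, 0 ≤ η x) →
    ∫ x, h x * η x ∂riemannianVolume n M ≤ affineLaplacianPairing u lam mu G η

end Affine

end AffineHardy

end

set_option linter.unusedSectionVars false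

/-! Write `c = τ + μ - λ` and `W = V^(τ+λ-μ)`. The value of `τ` gives `c = 2μ + nλ`, so `V^τ Δ^D f =
div(V^c ∇f)`. Testing the differential inequality with `V^τ ζ`, `ζ ≥ 0`, therefore turns it into `0
≤ s ∫ V^c ⟨∇ρ, ∇ζ⟩ + (C/ρ) W ζ`, with `s = 1` in case (i) and `s = -1` in case (ii)
(`affineLaplacianPairing_weight_rpow_mul`, `integral_mul_inner_grad_add`).

Now take `ζ = ρ^(α-1) φ²`. Since `|∇ρ| = V^(λ-μ)` almost everywhere, `V^c |∇ρ|² = W`, and the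
inequality becomes `κ ∫ ρ^(α-2) φ² W ≤ 2s ∫ ρ^(α-1) φ V^c ⟨∇ρ, ∇φ⟩` with `κ = -s(α - 1 + C) > 0`.
Cauchy-Schwarz and Young's inequality bound the right side by `(κ/2) ∫ ρ^(α-2) φ² W + (2/κ) ∫ ρ^α
|∇^D φ|² W`; absorbing the first term gives the constant `(κ/2)²` (`hardy_of_weak_inequality`).

The analytic difficulty is that this `ζ` is not smooth, because `ρ` has only a weak gradient. As
`|∇ρ|` equals a continuous function almost everywhere, weak derivatives in charts are locally
bounded. Mollifying `ρ` in a chart gives smooth `R_k → ρ` uniformly on compact sets, with `⟨∇ρ,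
∇R_k⟩ → |∇ρ|²` almost everywhere and boundedly (`IsWeakGradient.exists_smooth_approx`). Dominated
convergence for `R_k^(α-1) ψ`, followed by a partition of unity, admits the desired test function
(`testIntegrand_nonneg`). -/

noncomputable section

namespace AffineHardy

/-! ### Coordinate vectors and the Gram matrix in charts -/

section ChartGeometry

variable {n : ℕ} {M : Type*} [TopologicalSpace M] [ChartedSpace (EuclideanSpace ℝ (Fin n)) M]

lemma chartVector_smul (p : M) (y w : EuclideanSpace ℝ (Fin n)) (c : ℝ) :
    chartVector p y (c • w) = c • chartVector p y w :=
  map_smul (mfderiv (𝓡 n) (𝓡 n) (chartAt (EuclideanSpace ℝ (Fin n)) p).symm y) c w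

lemma chartVector_zero (p : M) (y : EuclideanSpace ℝ (Fin n)) : chartVector p y 0 = 0 :=
  map_zero (mfderiv (𝓡 n) (𝓡 n) (chartAt (EuclideanSpace ℝ (Fin n)) p).symm y)

lemma chartVector_sum (p : M) (y : EuclideanSpace ℝ (Fin n)) {ι : Type*} (s : Finset ι)
    (f : ι → EuclideanSpace ℝ (Fin n)) :
    chartVector p y (∑ i ∈ s, f i) = ∑ i ∈ s, chartVector p y (f i) :=
  map_sum (mfderiv (𝓡 n) (𝓡 n) (chartAt (EuclideanSpace ℝ (Fin n)) p).symm y) f s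

lemma eq_sum_single (w : EuclideanSpace ℝ (Fin n)) :
    w = ∑ i, w i • (EuclideanSpace.single i (1 : ℝ) : EuclideanSpace ℝ (Fin n)) := by
  ext j
  simp [Finset.sum_apply, Pi.single_apply]

lemma chartVector_eq_sum (p : M) (y w : EuclideanSpace ℝ (Fin n)) :
    chartVector p y w = ∑ i, w i • chartVector p y (EuclideanSpace.single i 1) := by
  conv_lhs => rw [eq_sum_single w, chartVector_sum]
  simp only [chartVector_smul]

section Gram

variable [RiemannianBundle (fun x : M => TangentSpace (𝓡 n) x)]

lemma inner_chartVector (p : M) (y v w : EuclideanSpace ℝ (Fin n)) :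
    inner ℝ (chartVector p y v) (chartVector p y w) =
      ∑ i, ∑ j, v i * w j * gramMatrix p y i j := by
  rw [chartVector_eq_sum p y v, chartVector_eq_sum p y w, sum_inner]
  refine Finset.sum_congr rfl fun i _ => ?_
  rw [inner_sum]
  refine Finset.sum_congr rfl fun j _ => ?_
  rw [real_inner_smul_left, real_inner_smul_right, gramMatrix]
  ring

/-- When `w` holds the coordinates of a gradient, the right side is a partial derivative; this is
the linear system solved in `grad_eq_chartVector`. -/
lemma gramMatrix_mulVec (p : M) (y w : EuclideanSpace ℝ (Fin n)) (i : Fin n) :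
    (gramMatrix p y).mulVec w.ofLp i =
      inner ℝ (chartVector p y (EuclideanSpace.single i 1)) (chartVector p y w) := by
  rw [chartVector_eq_sum p y w, inner_sum, Matrix.mulVec, dotProduct]
  refine Finset.sum_congr rfl fun j _ => ?_
  rw [real_inner_smul_right, gramMatrix, mul_comm]

end Gram

variable [IsManifold (𝓡 n) ∞ M]

lemma mdifferentiableAt_chartAt_symm (p : M) {y : EuclideanSpace ℝ (Fin n)}
    (hy : y ∈ (chartAt (EuclideanSpace ℝ (Fin n)) p).target) :
    MDifferentiableAt (𝓡 n) (𝓡 n) (chartAt (EuclideanSpace ℝ (Fin n)) p).symm y :=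
  (mdifferentiable_chart (I := 𝓡 n) p).mdifferentiableAt_symm hy

lemma chartVector_bijective (p : M) {y : EuclideanSpace ℝ (Fin n)}
    (hy : y ∈ (chartAt (EuclideanSpace ℝ (Fin n)) p).target) :
    Function.Bijective (chartVector p y) :=
  ((mdifferentiable_chart (I := 𝓡 n) p).symm.mfderiv hy).bijective

lemma mvfderiv_chartVector {f : M → ℝ} (p : M) {y : EuclideanSpace ℝ (Fin n)}
    (hy : y ∈ (chartAt (EuclideanSpace ℝ (Fin n)) p).target)
    (hf : MDifferentiableAt (𝓡 n) 𝓘(ℝ, ℝ) f ((chartAt (EuclideanSpace ℝ (Fin n)) p).symm y))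
    (w : EuclideanSpace ℝ (Fin n)) :
    mvfderiv (𝓡 n) f ((chartAt (EuclideanSpace ℝ (Fin n)) p).symm y) (chartVector p y w) =
      fderiv ℝ (f ∘ (chartAt (EuclideanSpace ℝ (Fin n)) p).symm) y w := by
  have h := mvfderiv_comp_apply (𝕜 := ℝ) y hf (mdifferentiableAt_chartAt_symm p hy) w
  rw [← mfderiv_eq_fderiv]
  exact h.symm

/-- Change of charts for coordinate vectors. -/
lemma chartVector_transition (p q : M) {y : EuclideanSpace ℝ (Fin n)}
    (hy : y ∈ (chartAt (EuclideanSpace ℝ (Fin n)) p).target)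
    (hq : (chartAt (EuclideanSpace ℝ (Fin n)) p).symm y ∈
      (chartAt (EuclideanSpace ℝ (Fin n)) q).source) :
    DifferentiableAt ℝ (chartAt (EuclideanSpace ℝ (Fin n)) q ∘
      (chartAt (EuclideanSpace ℝ (Fin n)) p).symm) y ∧ ∀ w, chartVector p y w =
    chartVector q (chartAt (EuclideanSpace ℝ (Fin n)) q
        ((chartAt (EuclideanSpace ℝ (Fin n)) p).symm y))
      (fderiv ℝ (chartAt (EuclideanSpace ℝ (Fin n)) q ∘
        (chartAt (EuclideanSpace ℝ (Fin n)) p).symm) y w) := by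
  set e := chartAt (EuclideanSpace ℝ (Fin n)) p with he
  set e' := chartAt (EuclideanSpace ℝ (Fin n)) q with he'
  have h1 : MDifferentiableAt (𝓡 n) (𝓡 n) e.symm y := mdifferentiableAt_chartAt_symm p hy
  have h2 : MDifferentiableAt (𝓡 n) (𝓡 n) e' (e.symm y) :=
    (mdifferentiable_chart (I := 𝓡 n) q).mdifferentiableAt hq
  have h3 : MDifferentiableAt (𝓡 n) (𝓡 n) (e' ∘ e.symm) y := h2.comp y h1
  refine ⟨mdifferentiableAt_iff_differentiableAt.1 h3, fun w => ?_⟩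
  have h4 : MDifferentiableAt (𝓡 n) (𝓡 n) e'.symm ((e' ∘ e.symm) y) :=
    mdifferentiableAt_chartAt_symm q (e'.map_source hq)
  have h5 : e'.symm ∘ (e' ∘ e.symm) =ᶠ[𝓝 y] e.symm := by
    have : e.symm ⁻¹' e'.source ∈ 𝓝 y :=
      (e.continuousAt_symm hy).preimage_mem_nhds (e'.open_source.mem_nhds hq)
    filter_upwards [this] with z hz
    exact e'.left_inv hz
  have h6 := mfderiv_comp_apply (I := 𝓡 n) (I' := 𝓡 n) (I'' := 𝓡 n) y h4 h3 w
  rw [h5.mfderiv_eq] at h6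
  rw [← mfderiv_eq_fderiv]
  exact h6

/-- `chartVector` is the fibre part of the tangent map of the inverse chart, which is continuous
because the inverse chart is C¹. The total-space form is the one to which continuity of the metric
applies. -/
lemma continuousOn_chartVector (p : M) {X : Type*} [TopologicalSpace X] {s : Set X}
    {a b : X → EuclideanSpace ℝ (Fin n)} (ha : ContinuousOn a s) (hb : ContinuousOn b s)
    (has : ∀ x ∈ s, a x ∈ (chartAt (EuclideanSpace ℝ (Fin n)) p).target) :
    ContinuousOn (fun x => (⟨(chartAt (EuclideanSpace ℝ (Fin n)) p).symm (a x),
      chartVector p (a x) (b x)⟩ : TotalSpace (EuclideanSpace ℝ (Fin n))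
        (fun x : M => TangentSpace (𝓡 n) x))) s := by
  set e := chartAt (EuclideanSpace ℝ (Fin n)) p with he
  have h1 := (contMDiffOn_chart_symm (I := 𝓡 n) (n := 1) (x := p)).continuousOn_tangentMapWithin
    le_rfl e.open_target.uniqueMDiffOn
  have h2 : ContinuousOn (fun x => (tangentBundleModelSpaceHomeomorph (𝓡 n)).symm
      ((a x, b x) : ModelProd (EuclideanSpace ℝ (Fin n)) (EuclideanSpace ℝ (Fin n)))) s :=
    (tangentBundleModelSpaceHomeomorph (𝓡 n)).symm.continuous.comp_continuousOn (ha.prodMk hb)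
  refine (h1.comp h2 fun x hx => has x hx).congr fun x hx => ?_
  have h3 : mfderivWithin (𝓡 n) (𝓡 n) e.symm e.target (a x) =
      mfderiv (𝓡 n) (𝓡 n) e.symm (a x) :=
    mfderivWithin_of_isOpen e.open_target (has x hx)
  simp only [Function.comp_apply, tangentMapWithin]
  change _ = TotalSpace.mk (e.symm (a x)) (mfderivWithin (𝓡 n) (𝓡 n) e.symm e.target (a x) (b x))
  rw [h3]
  rfl

variable [RiemannianBundle (fun x : M => TangentSpace (𝓡 n) x)]

lemma gramMatrix_posDef (p : M) {y : EuclideanSpace ℝ (Fin n)}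
    (hy : y ∈ (chartAt (EuclideanSpace ℝ (Fin n)) p).target) : (gramMatrix p y).PosDef := by
  refine Matrix.PosDef.of_dotProduct_mulVec_pos ?_ fun x hx => ?_
  · ext i j
    simp [gramMatrix, real_inner_comm]
  · have h : star x ⬝ᵥ (gramMatrix p y).mulVec x =
        inner ℝ (chartVector p y (WithLp.toLp 2 x)) (chartVector p y (WithLp.toLp 2 x)) := by
      rw [inner_chartVector, dotProduct]
      refine Finset.sum_congr rfl fun i _ => ?_
      rw [Matrix.mulVec, dotProduct, Finset.mul_sum]
      refine Finset.sum_congr rfl fun j _ => ?_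
      simp; ring
    rw [h, real_inner_self_pos]
    intro h0
    rw [← chartVector_zero p y] at h0
    have := (chartVector_bijective p hy).1 h0
    exact hx (by simpa using congrArg WithLp.ofLp this)

lemma gramMatrix_det_pos (p : M) {y : EuclideanSpace ℝ (Fin n)}
    (hy : y ∈ (chartAt (EuclideanSpace ℝ (Fin n)) p).target) : 0 < (gramMatrix p y).det :=
  (gramMatrix_posDef p hy).det_pos

/-- With `J` the Jacobian of the transition map, the Gram matrices satisfy `G_p = Jᵀ G_q J`. The
square root of the factor `(det J)²` is exactly the Jacobian factor in the change of variables. -/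
lemma det_gramMatrix_transition (p q : M) {y : EuclideanSpace ℝ (Fin n)}
    (hy : y ∈ (chartAt (EuclideanSpace ℝ (Fin n)) p).target)
    (hq : (chartAt (EuclideanSpace ℝ (Fin n)) p).symm y ∈
      (chartAt (EuclideanSpace ℝ (Fin n)) q).source) :
    (gramMatrix p y).det = (fderiv ℝ (chartAt (EuclideanSpace ℝ (Fin n)) q ∘
        (chartAt (EuclideanSpace ℝ (Fin n)) p).symm) y).det ^ 2 *
      (gramMatrix q (chartAt (EuclideanSpace ℝ (Fin n)) q
        ((chartAt (EuclideanSpace ℝ (Fin n)) p).symm y))).det := by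
  set z := chartAt (EuclideanSpace ℝ (Fin n)) q
    ((chartAt (EuclideanSpace ℝ (Fin n)) p).symm y) with hz
  set T := fderiv ℝ (chartAt (EuclideanSpace ℝ (Fin n)) q ∘
        (chartAt (EuclideanSpace ℝ (Fin n)) p).symm) y with hT
  have hv := (chartVector_transition p q hy hq).2
  set b := (EuclideanSpace.basisFun (Fin n) ℝ).toBasis with hb
  set J := LinearMap.toMatrix b b (T : EuclideanSpace ℝ (Fin n) →ₗ[ℝ] EuclideanSpace ℝ (Fin n))
    with hJ
  have hdet : J.det = T.det := LinearMap.det_toMatrix b _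
  have hJe : ∀ i j, J i j = T (EuclideanSpace.single j 1) i := fun i j => by
    simp [hJ, LinearMap.toMatrix_apply, hb]
  have hxy : (chartAt (EuclideanSpace ℝ (Fin n)) q).symm z =
      (chartAt (EuclideanSpace ℝ (Fin n)) p).symm y :=
    (chartAt (EuclideanSpace ℝ (Fin n)) q).left_inv hq
  have key : gramMatrix p y = J.transpose * gramMatrix q z * J := by
    ext i j
    have h1 : gramMatrix p y i j = inner ℝ (chartVector q z (T (EuclideanSpace.single i 1)))
        (chartVector q z (T (EuclideanSpace.single j 1))) := by
      -- The tangent spaces at equal points share one model space, but the inner product depends on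
      -- the base point and has to be transported along the equality.
      have inner_eq : ∀ {x x' : M}, x = x' → ∀ v w : EuclideanSpace ℝ (Fin n),
          inner ℝ (show TangentSpace (𝓡 n) x from v) (show TangentSpace (𝓡 n) x from w) =
          inner ℝ (show TangentSpace (𝓡 n) x' from v) (show TangentSpace (𝓡 n) x' from w) := by
        rintro x _ rfl v w
        rfl
      rw [gramMatrix, hv, hv]
      exact inner_eq hxy.symm _ _
    rw [h1, inner_chartVector, Matrix.mul_assoc, Matrix.mul_apply]
    refine Finset.sum_congr rfl fun k _ => ?_
    rw [Matrix.mul_apply, Finset.mul_sum]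
    refine Finset.sum_congr rfl fun l _ => ?_
    rw [Matrix.transpose_apply, hJe, hJe]
    ring
  rw [key, Matrix.det_mul, Matrix.det_mul, Matrix.det_transpose, hdet]
  ring

variable [IsContMDiffRiemannianBundle (𝓡 n) ∞ (EuclideanSpace ℝ (Fin n))
      (fun x : M => TangentSpace (𝓡 n) x)]

instance isContinuousRiemannianBundle_tangentSpace :
    IsContinuousRiemannianBundle (EuclideanSpace ℝ (Fin n))
      (fun x : M => TangentSpace (𝓡 n) x) := by
  obtain ⟨g, hg, h⟩ := IsContMDiffRiemannianBundle.exists_contMDiff (IB := 𝓡 n) (n := ∞)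
    (F := EuclideanSpace ℝ (Fin n)) (E := fun x : M => TangentSpace (𝓡 n) x)
  exact ⟨g, hg.continuous, h⟩

lemma continuousOn_inner_chartVector (p : M) {X : Type*} [TopologicalSpace X] {s : Set X}
    {a b c : X → EuclideanSpace ℝ (Fin n)} (ha : ContinuousOn a s) (hb : ContinuousOn b s)
    (hc : ContinuousOn c s)
    (has : ∀ x ∈ s, a x ∈ (chartAt (EuclideanSpace ℝ (Fin n)) p).target) :
    ContinuousOn (fun x => inner ℝ (chartVector p (a x) (b x)) (chartVector p (a x) (c x))) s :=
  (continuousOn_chartVector p ha hb has).inner_bundle (continuousOn_chartVector p ha hc has)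

lemma continuousOn_gramMatrix (p : M) :
    ContinuousOn (gramMatrix p) (chartAt (EuclideanSpace ℝ (Fin n)) p).target :=
  continuousOn_pi.2 fun _ => continuousOn_pi.2 fun _ =>
    continuousOn_inner_chartVector p continuousOn_id continuousOn_const continuousOn_const
      fun _ h => h

lemma continuousOn_sqrt_det_gramMatrix (p : M) :
    ContinuousOn (fun y => Real.sqrt (gramMatrix p y).det)
      (chartAt (EuclideanSpace ℝ (Fin n)) p).target :=
  (Continuous.matrix_det continuous_id).comp_continuousOn (continuousOn_gramMatrix p) |>.sqrt

lemma continuousOn_gramMatrix_inv (p : M) :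
    ContinuousOn (fun y => (gramMatrix p y)⁻¹) (chartAt (EuclideanSpace ℝ (Fin n)) p).target := by
  simp only [Matrix.inv_def, Ring.inverse_eq_inv']
  refine ContinuousOn.smul (ContinuousOn.inv₀
    ((Continuous.matrix_det continuous_id).comp_continuousOn (continuousOn_gramMatrix p))
      fun y hy => (gramMatrix_det_pos p hy).ne') ?_
  exact (Continuous.matrix_adjugate continuous_id).comp_continuousOn (continuousOn_gramMatrix p)

/-- On compact subsets of a chart, the Euclidean norm is controlled by the Riemannian norm. -/
lemma exists_norm_le_norm_chartVector (p : M) {K : Set (EuclideanSpace ℝ (Fin n))}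
    (hK : IsCompact K) (hKt : K ⊆ (chartAt (EuclideanSpace ℝ (Fin n)) p).target) :
    ∃ c : ℝ, 0 ≤ c ∧ ∀ y ∈ K, ∀ w, ‖w‖ ≤ c * ‖chartVector p y w‖ := by
  set S := K ×ˢ Metric.sphere (0 : EuclideanSpace ℝ (Fin n)) 1 with hS
  have hSc : IsCompact S := hK.prod (isCompact_sphere _ _)
  have hcont : ContinuousOn (fun x : EuclideanSpace ℝ (Fin n) × EuclideanSpace ℝ (Fin n) =>
      ‖chartVector p x.1 x.2‖⁻¹) S := by
    refine ContinuousOn.inv₀ ?_ fun x hx h0 => ?_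
    · simp only [@norm_eq_sqrt_real_inner]
      exact (continuousOn_inner_chartVector p continuousOn_fst continuousOn_snd continuousOn_snd
        fun x hx => hKt hx.1).sqrt
    · rw [norm_eq_zero, ← chartVector_zero p x.1] at h0
      have := (chartVector_bijective p (hKt hx.1)).1 h0
      have h1 := hx.2
      simp [this] at h1
  obtain ⟨c, hc⟩ := hSc.bddAbove_image hcont
  -- If the compact set `S` is empty, `c` may be negative.
  refine ⟨max c 0, le_max_right _ _, fun y hy w => ?_⟩
  rcases eq_or_ne w 0 with rfl | hw
  · simp [chartVector_zero]
  have hn : 0 < ‖w‖ := norm_pos_iff.2 hw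
  have h1 : ‖chartVector p y (‖w‖⁻¹ • w)‖⁻¹ ≤ c :=
    hc ⟨(y, ‖w‖⁻¹ • w), ⟨hy, by simp [norm_smul, hn.ne']⟩, rfl⟩
  rw [chartVector_smul, norm_smul, norm_inv, norm_norm, mul_inv, inv_inv] at h1
  have hpos : 0 < ‖chartVector p y w‖ := by
    rw [norm_pos_iff]
    intro h0
    rw [← chartVector_zero p y] at h0
    exact hw ((chartVector_bijective p (hKt hy)).1 h0)
  rw [← div_eq_mul_inv, div_le_iff₀ hpos] at h1
  exact h1.trans (by gcongr; exact le_max_left _ _)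

end ChartGeometry

/-! ### The Riemannian volume and its restriction to charts -/

section Volume

lemma measurableSet_preimage_inter_of_continuousOn {X Y : Type*} [TopologicalSpace X]
    [MeasurableSpace X] [OpensMeasurableSpace X] [TopologicalSpace Y] [MeasurableSpace Y]
    [BorelSpace Y] {f : X → Y} {s : Set X} (hf : ContinuousOn f s) (hs : MeasurableSet s)
    {A : Set Y} (hA : MeasurableSet A) : MeasurableSet (f ⁻¹' A ∩ s) := by
  have h := hs.subtype_image ((continuousOn_iff_continuous_domRestrict.1 hf).measurable hA)
  convert h using 1
  ext x
  simp [and_comm]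

variable {n : ℕ} {M : Type*} [TopologicalSpace M] [ChartedSpace (EuclideanSpace ℝ (Fin n)) M]
  [IsManifold (𝓡 n) ∞ M]
  [RiemannianBundle (fun x : M => TangentSpace (𝓡 n) x)]
  [IsContMDiffRiemannianBundle (𝓡 n) ∞ (EuclideanSpace ℝ (Fin n))
      (fun x : M => TangentSpace (𝓡 n) x)]

lemma aemeasurable_volumeDensity (p : M) :
    AEMeasurable (fun y => ENNReal.ofReal (Real.sqrt (gramMatrix p y).det))
      (volume.restrict (chartAt (EuclideanSpace ℝ (Fin n)) p).target) :=
  ((continuousOn_sqrt_det_gramMatrix p).aemeasurable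
    (chartAt (EuclideanSpace ℝ (Fin n)) p).open_target.measurableSet).ennreal_ofReal

/-- In coordinates, Lebesgue measure is absolutely continuous with respect to the volume. -/
lemma volume_absolutelyContinuous_withDensity (p : M) :
    volume.restrict (chartAt (EuclideanSpace ℝ (Fin n)) p).target ≪
      (volume.restrict (chartAt (EuclideanSpace ℝ (Fin n)) p).target).withDensity
        (fun y => ENNReal.ofReal (Real.sqrt (gramMatrix p y).det)) := by
  refine withDensity_absolutelyContinuous' (aemeasurable_volumeDensity p) ?_
  filter_upwards [ae_restrict_mem
    (chartAt (EuclideanSpace ℝ (Fin n)) p).open_target.measurableSet] with y hy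
  simpa using gramMatrix_det_pos p hy

variable [MeasurableSpace M] [BorelSpace M]

lemma aemeasurable_chartAt_symm (p : M) :
    AEMeasurable (chartAt (EuclideanSpace ℝ (Fin n)) p).symm
      (volume.restrict (chartAt (EuclideanSpace ℝ (Fin n)) p).target) :=
  (chartAt (EuclideanSpace ℝ (Fin n)) p).continuousOn_symm.aemeasurable
    (chartAt (EuclideanSpace ℝ (Fin n)) p).open_target.measurableSet

lemma chartVolume_apply (p : M) {A : Set M} (hA : MeasurableSet A) :
    chartVolume (n := n) p A = ∫⁻ y in (chartAt (EuclideanSpace ℝ (Fin n)) p).symm ⁻¹' A ∩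
        (chartAt (EuclideanSpace ℝ (Fin n)) p).target,
      ENNReal.ofReal (Real.sqrt (gramMatrix p y).det) := by
  rw [chartVolume, Measure.map_apply_of_aemeasurable
    ((aemeasurable_chartAt_symm p).mono_ac (withDensity_absolutelyContinuous _ _)) hA,
    withDensity_apply', Measure.restrict_restrict'
      (chartAt (EuclideanSpace ℝ (Fin n)) p).open_target.measurableSet]

lemma chartVolume_compl_source (p : M) :
    chartVolume (n := n) p (chartAt (EuclideanSpace ℝ (Fin n)) p).sourceᶜ = 0 := by
  rw [chartVolume_apply p (chartAt (EuclideanSpace ℝ (Fin n)) p).open_source.measurableSet.compl]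
  have : (chartAt (EuclideanSpace ℝ (Fin n)) p).symm ⁻¹'
      (chartAt (EuclideanSpace ℝ (Fin n)) p).sourceᶜ ∩
        (chartAt (EuclideanSpace ℝ (Fin n)) p).target = ∅ := by
    ext y
    exact ⟨fun h => h.1 ((chartAt (EuclideanSpace ℝ (Fin n)) p).map_target h.2), False.elim⟩
  rw [this, setLIntegral_empty]

lemma chartVolume_restrict_source (p : M) :
    (chartVolume (n := n) p).restrict (chartAt (EuclideanSpace ℝ (Fin n)) p).source = chartVolume (n := n) p :=
  Measure.restrict_eq_self_of_ae_mem (by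
    rw [ae_iff]
    exact chartVolume_compl_source p)

/-- Change of variables along the transition map: the factor `|det J|` is absorbed by
`det_gramMatrix_transition`. -/
lemma chartVolume_eq_of_subset (p q : M) {A : Set M} (hA : MeasurableSet A)
    (hAp : A ⊆ (chartAt (EuclideanSpace ℝ (Fin n)) p).source)
    (hAq : A ⊆ (chartAt (EuclideanSpace ℝ (Fin n)) q).source) :
    chartVolume (n := n) p A = chartVolume (n := n) q A := by
  rw [chartVolume_apply p hA, chartVolume_apply q hA]
  set e := chartAt (EuclideanSpace ℝ (Fin n)) p with he
  set e' := chartAt (EuclideanSpace ℝ (Fin n)) q with he'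
  have himg : (e' ∘ e.symm) '' (e.symm ⁻¹' A ∩ e.target) = e'.symm ⁻¹' A ∩ e'.target := by
    ext z
    constructor
    · rintro ⟨y, ⟨hy, hyt⟩, rfl⟩
      have h := hAq hy
      refine ⟨?_, e'.map_source h⟩
      change e'.symm (e' (e.symm y)) ∈ A
      rwa [e'.left_inv h]
    · rintro ⟨hz, hzt⟩
      have h := hAp hz
      refine ⟨e (e'.symm z), ⟨?_, e.map_source h⟩, ?_⟩
      · change e.symm (e (e'.symm z)) ∈ A
        rwa [e.left_inv h]
      · simp only [Function.comp_apply]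
        rw [e.left_inv h, e'.right_inv hzt]
  have hmeas : MeasurableSet (e.symm ⁻¹' A ∩ e.target) :=
    measurableSet_preimage_inter_of_continuousOn e.continuousOn_symm e.open_target.measurableSet hA
  rw [← himg, lintegral_image_eq_lintegral_abs_det_fderiv_mul volume hmeas
    (f' := fun y => fderiv ℝ (e' ∘ e.symm) y)
    (fun y hy => (chartVector_transition p q hy.2
      (hAq hy.1)).1.hasFDerivAt.hasFDerivWithinAt)]
  · refine setLIntegral_congr_fun hmeas fun y hy => ?_
    rw [det_gramMatrix_transition p q hy.2 (hAq hy.1), Real.sqrt_mul (sq_nonneg _),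
      Real.sqrt_sq_eq_abs, ENNReal.ofReal_mul (abs_nonneg _)]
    rfl
  · intro y hy z hz hyz
    have h1 : e.symm y = e.symm z := e'.injOn (hAq hy.1) (hAq hz.1) hyz
    exact e.symm.injOn hy.2 hz.2 h1

/-- On the domain of a chart, the Riemannian volume is given by `√(det g_ij) dy`. -/
lemma riemannianVolume_restrict_source (p : M) :
    (riemannianVolume n M).restrict (chartAt (EuclideanSpace ℝ (Fin n)) p).source =
      chartVolume (n := n) p := by
  set e := chartAt (EuclideanSpace ℝ (Fin n)) p with he
  have hes := e.open_source.measurableSet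
  refine le_antisymm ?_ ?_
  -- A supremum of measures is controlled through an upper bound: the measure on the right dominates
  -- every `chartVolume q`. Inside the source of `p` the two chart volumes agree; outside it the
  -- second summand suffices.
  · have h : riemannianVolume n M ≤
        chartVolume (n := n) p + (riemannianVolume n M).restrict e.sourceᶜ := by
      refine iSup_le fun q => Measure.le_iff.2 fun A hA => ?_
      set e' := chartAt (EuclideanSpace ℝ (Fin n)) q with he'
      have hes' := e'.open_source.measurableSet
      rw [← measure_inter_add_sdiff A hes, Measure.add_apply, Measure.restrict_apply hA]
      refine add_le_add ?_ ?_
      · rw [← chartVolume_restrict_source q, Measure.restrict_apply (hA.inter hes),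
          ← chartVolume_eq_of_subset p q ((hA.inter hes).inter hes')
            (fun x hx => hx.1.2) (fun x hx => hx.2)]
        exact measure_mono fun x hx => hx.1.1
      · rw [sdiff_eq]
        exact (le_iSup (fun p : M => chartVolume (n := n) p) q) _
    calc _ ≤ (chartVolume (n := n) p + (riemannianVolume n M).restrict e.sourceᶜ).restrict e.source :=
          Measure.restrict_mono le_rfl h
      _ = chartVolume (n := n) p := by
          rw [Measure.restrict_add, chartVolume_restrict_source,
            Measure.restrict_restrict hes]
          simp
  · rw [← chartVolume_restrict_source p]
    exact Measure.restrict_mono le_rfl (le_iSup (fun p : M => chartVolume (n := n) p) p)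

/-- The volume dominates `chartVolume p`, whose density is positive on the chart target, so
volume-null sets are Lebesgue-null in coordinates. -/
lemma ae_chart_of_ae (p : M) {P : M → Prop} (h : ∀ᵐ x ∂riemannianVolume n M, P x) :
    ∀ᵐ y ∂volume.restrict (chartAt (EuclideanSpace ℝ (Fin n)) p).target,
      P ((chartAt (EuclideanSpace ℝ (Fin n)) p).symm y) := by
  have h1 : ∀ᵐ x ∂chartVolume (n := n) p, P x :=
    ae_mono (le_iSup (fun p : M => chartVolume (n := n) p) p) h
  exact (volume_absolutelyContinuous_withDensity p).ae_le
    (ae_of_ae_map ((aemeasurable_chartAt_symm p).mono_ac (withDensity_absolutelyContinuous _ _)) h1)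

/-- A chart is quasi-measure-preserving from the Riemannian volume to Lebesgue measure. -/
lemma chartAt_map_absolutelyContinuous (p : M) :
    AEMeasurable (chartAt (EuclideanSpace ℝ (Fin n)) p) ((riemannianVolume n M).restrict
      (chartAt (EuclideanSpace ℝ (Fin n)) p).source) ∧
    ((riemannianVolume n M).restrict (chartAt (EuclideanSpace ℝ (Fin n)) p).source).map
      (chartAt (EuclideanSpace ℝ (Fin n)) p) ≪
      volume.restrict (chartAt (EuclideanSpace ℝ (Fin n)) p).target := by
  set e := chartAt (EuclideanSpace ℝ (Fin n)) p with he
  have hm : AEMeasurable e ((riemannianVolume n M).restrict e.source) :=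
    e.continuousOn.aemeasurable e.open_source.measurableSet
  refine ⟨hm, ?_⟩
  rw [riemannianVolume_restrict_source] at hm ⊢
  rw [chartVolume] at hm ⊢
  rw [AEMeasurable.map_map_of_aemeasurable hm
    ((aemeasurable_chartAt_symm p).mono_ac (withDensity_absolutelyContinuous _ _))]
  have hid : (e ∘ e.symm) =ᵐ[(volume.restrict e.target).withDensity
      (fun y => ENNReal.ofReal (Real.sqrt (gramMatrix p y).det))] id := by
    refine (withDensity_absolutelyContinuous _ _).ae_le ?_
    filter_upwards [ae_restrict_mem e.open_target.measurableSet] with y hy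
    exact e.right_inv hy
  rw [Measure.map_congr hid, Measure.map_id]
  exact withDensity_absolutelyContinuous _ _

lemma aestronglyMeasurable_source_of_chart (p : M) {f : M → ℝ}
    (h : AEStronglyMeasurable (f ∘ (chartAt (EuclideanSpace ℝ (Fin n)) p).symm)
      (volume.restrict (chartAt (EuclideanSpace ℝ (Fin n)) p).target)) :
    AEStronglyMeasurable f ((riemannianVolume n M).restrict
      (chartAt (EuclideanSpace ℝ (Fin n)) p).source) := by
  obtain ⟨h1, h2⟩ := chartAt_map_absolutelyContinuous (n := n) p
  refine ((h.mono_ac h2).comp_aemeasurable h1).congr ?_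
  filter_upwards [ae_restrict_mem
    (chartAt (EuclideanSpace ℝ (Fin n)) p).open_source.measurableSet] with x hxs
  simp [(chartAt (EuclideanSpace ℝ (Fin n)) p).left_inv hxs]

/-- The density is continuous on a closed ball inside the chart target, hence integrable there.
Local finiteness makes continuous compactly supported functions integrable. -/
instance isLocallyFiniteMeasure_riemannianVolume :
    IsLocallyFiniteMeasure (riemannianVolume n M) := by
  refine ⟨fun p => ?_⟩
  set e := chartAt (EuclideanSpace ℝ (Fin n)) p with he
  have hp : p ∈ e.source := mem_chart_source _ p
  obtain ⟨r, hr, hball⟩ := Metric.nhds_basis_closedBall.mem_iff.1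
    (e.open_target.mem_nhds (e.map_source hp))
  have hopen : IsOpen (e.source ∩ e ⁻¹' Metric.ball (e p) r) :=
    e.isOpen_inter_preimage Metric.isOpen_ball
  refine ⟨_, hopen.mem_nhds ⟨hp, Metric.mem_ball_self hr⟩, ?_⟩
  have h1 : riemannianVolume n M (e.source ∩ e ⁻¹' Metric.ball (e p) r) =
      chartVolume (n := n) p (e.source ∩ e ⁻¹' Metric.ball (e p) r) := by
    rw [← riemannianVolume_restrict_source, Measure.restrict_apply hopen.measurableSet]
    congr 1
    ext x
    simp only [mem_inter_iff]
    tauto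
  rw [h1, chartVolume_apply p hopen.measurableSet]
  have hsub : e.symm ⁻¹' (e.source ∩ e ⁻¹' Metric.ball (e p) r) ∩ e.target ⊆
      Metric.closedBall (e p) r := by
    rintro y ⟨⟨_, hy⟩, hyt⟩
    rw [mem_preimage, e.right_inv hyt] at hy
    exact Metric.ball_subset_closedBall hy
  refine (lintegral_mono_set hsub).trans_lt ?_
  have hint : IntegrableOn (fun y => Real.sqrt (gramMatrix p y).det)
      (Metric.closedBall (e p) r) :=
    ((continuousOn_sqrt_det_gramMatrix p).mono hball).integrableOn_compact
      (isCompact_closedBall _ _)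
  exact hint.lintegral_lt_top

lemma aestronglyMeasurable_of_source [SecondCountableTopology M] {f : M → ℝ}
    (h : ∀ p : M, AEStronglyMeasurable f ((riemannianVolume n M).restrict
      (chartAt (EuclideanSpace ℝ (Fin n)) p).source)) :
    AEStronglyMeasurable f (riemannianVolume n M) := by
  obtain ⟨s, hs, hcov⟩ := TopologicalSpace.countable_cover_nhds
    fun p : M => chart_source_mem_nhds (EuclideanSpace ℝ (Fin n)) p
  have := hs.to_subtype
  rw [← Measure.restrict_univ (μ := riemannianVolume n M), ← hcov, biUnion_eq_iUnion,
    aestronglyMeasurable_iUnion_iff]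
  exact fun p => h p

end Volume

/-! ### Riemannian gradients in coordinates -/

section Gradient

variable {n : ℕ} {M : Type*} [TopologicalSpace M] [ChartedSpace (EuclideanSpace ℝ (Fin n)) M]
  [RiemannianBundle (fun x : M => TangentSpace (𝓡 n) x)]

lemma inner_grad_left (f : M → ℝ) (x : M) (v : TangentSpace (𝓡 n) x) :
    inner ℝ (grad f x) v = mvfderiv (𝓡 n) f x v :=
  InnerProductSpace.toDual_symm_apply

lemma inner_grad_right (f : M → ℝ) (x : M) (v : TangentSpace (𝓡 n) x) :
    inner ℝ v (grad f x) = mvfderiv (𝓡 n) f x v := by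
  rw [real_inner_comm, inner_grad_left]

lemma grad_mul {f g : M → ℝ} {x : M} (hf : MDifferentiableAt (𝓡 n) 𝓘(ℝ, ℝ) f x)
    (hg : MDifferentiableAt (𝓡 n) 𝓘(ℝ, ℝ) g x) :
    grad (n := n) (fun z => f z * g z) x = f x • grad g x + g x • grad f x := by
  refine ext_inner_right ℝ fun v => ?_
  rw [inner_add_left, real_inner_smul_left, real_inner_smul_left, inner_grad_left,
    inner_grad_left, inner_grad_left, mvfderiv_fun_mul hf hg]
  rfl

lemma grad_comp {f : M → ℝ} {x : M} {F : ℝ → ℝ} {F' : ℝ}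
    (hf : MDifferentiableAt (𝓡 n) 𝓘(ℝ, ℝ) f x) (hF : HasDerivAt F F' (f x)) :
    grad (n := n) (fun z => F (f z)) x = F' • grad f x := by
  refine ext_inner_right ℝ fun v => ?_
  rw [real_inner_smul_left, inner_grad_left, inner_grad_left]
  have h := mvfderiv_comp_apply (𝕜 := ℝ) (g := F) (I := 𝓘(ℝ, ℝ)) x
    hF.differentiableAt.mdifferentiableAt hf v
  refine h.trans ?_
  have h2 : mvfderiv 𝓘(ℝ, ℝ) F (f x) = fderiv ℝ F (f x) := by
    rw [← mfderiv_eq_fderiv]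
    rfl
  rw [h2, hF.hasFDerivAt.fderiv]
  change mvfderiv (𝓡 n) f x v * F' = _
  exact mul_comm _ _

/-- The coordinates of the gradient in the preferred chart around `p`. -/
def gradCoord (f : M → ℝ) (p : M) (y : EuclideanSpace ℝ (Fin n)) : EuclideanSpace ℝ (Fin n) :=
  WithLp.toLp 2 ((gramMatrix p y)⁻¹.mulVec fun i =>
    fderiv ℝ (f ∘ (chartAt (EuclideanSpace ℝ (Fin n)) p).symm) y (EuclideanSpace.single i 1))

variable [IsManifold (𝓡 n) ∞ M]

lemma grad_eq_chartVector {f : M → ℝ} (p : M) {y : EuclideanSpace ℝ (Fin n)}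
    (hy : y ∈ (chartAt (EuclideanSpace ℝ (Fin n)) p).target)
    (hf : MDifferentiableAt (𝓡 n) 𝓘(ℝ, ℝ) f ((chartAt (EuclideanSpace ℝ (Fin n)) p).symm y)) :
    grad f ((chartAt (EuclideanSpace ℝ (Fin n)) p).symm y) =
      chartVector p y (gradCoord f p y) := by
  obtain ⟨c, hc⟩ := (chartVector_bijective p hy).2
    (grad f ((chartAt (EuclideanSpace ℝ (Fin n)) p).symm y))
  rw [← hc]
  congr 1
  have h1 : (gramMatrix p y).mulVec c.ofLp = fun i =>
      fderiv ℝ (f ∘ (chartAt (EuclideanSpace ℝ (Fin n)) p).symm) y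
        (EuclideanSpace.single i 1) := by
    ext i
    rw [gramMatrix_mulVec, hc, inner_grad_right, mvfderiv_chartVector p hy hf]
  rw [gradCoord, ← h1, Matrix.mulVec_mulVec, Matrix.nonsing_inv_mul _
    (gramMatrix_det_pos p hy).ne'.isUnit, Matrix.one_mulVec]

variable [IsContMDiffRiemannianBundle (𝓡 n) ∞ (EuclideanSpace ℝ (Fin n))
      (fun x : M => TangentSpace (𝓡 n) x)]

lemma continuousOn_gradCoord {f : M → ℝ} (hf : ContMDiff (𝓡 n) 𝓘(ℝ, ℝ) ∞ f) (p : M) :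
    ContinuousOn (gradCoord (n := n) f p) (chartAt (EuclideanSpace ℝ (Fin n)) p).target := by
  set e := chartAt (EuclideanSpace ℝ (Fin n)) p with he
  have h1 : ContDiffOn ℝ ∞ (f ∘ e.symm) e.target :=
    contMDiffOn_iff_contDiffOn.1 (hf.comp_contMDiffOn contMDiffOn_chart_symm)
  have h2 : ContinuousOn (fun y => fderiv ℝ (f ∘ e.symm) y) e.target :=
    h1.continuousOn_fderiv_of_isOpen e.open_target (by simp)
  refine (PiLp.continuous_toLp 2 _).comp_continuousOn ?_
  have h3 : Continuous fun z : Matrix (Fin n) (Fin n) ℝ × (Fin n → ℝ) => z.1.mulVec z.2 :=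
    continuous_fst.matrix_mulVec continuous_snd
  exact h3.comp_continuousOn ((continuousOn_gramMatrix_inv p).prodMk
    (continuousOn_pi.2 fun i => h2.clm_apply continuousOn_const))

lemma continuous_inner_grad {f g : M → ℝ} (hf : ContMDiff (𝓡 n) 𝓘(ℝ, ℝ) ∞ f)
    (hg : ContMDiff (𝓡 n) 𝓘(ℝ, ℝ) ∞ g) :
    Continuous fun x => (inner ℝ (grad (n := n) f x) (grad g x) : ℝ) := by
  rw [continuous_iff_continuousAt]
  intro p
  set e := chartAt (EuclideanSpace ℝ (Fin n)) p with he
  have h1 := (continuousOn_inner_chartVector p continuousOn_id (continuousOn_gradCoord hf p)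
    (continuousOn_gradCoord hg p) fun x hx => hx).comp e.continuousOn fun x hx => e.map_source hx
  refine (h1.congr fun x hx => ?_).continuousAt
    (chart_source_mem_nhds (EuclideanSpace ℝ (Fin n)) p)
  obtain ⟨y, hy, rfl⟩ : ∃ y ∈ e.target, e.symm y = x := ⟨e x, e.map_source hx, e.left_inv hx⟩
  simp only [Function.comp_apply, id, e.right_inv hy]
  rw [grad_eq_chartVector p hy (hf.mdifferentiable (by simp) _),
    grad_eq_chartVector p hy (hg.mdifferentiable (by simp) _), inner_chartVector,
    inner_chartVector, e.right_inv hy]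

lemma continuous_norm_grad {f : M → ℝ} (hf : ContMDiff (𝓡 n) 𝓘(ℝ, ℝ) ∞ f) :
    Continuous fun x => ‖grad (n := n) f x‖ := by
  simp only [@norm_eq_sqrt_real_inner]
  exact (continuous_inner_grad hf hf).sqrt

/-- Measurability of `G` is available only through its pairings with coordinate vectors. Expanding
`grad f` in the coordinate frame gives a finite sum of continuous coefficients times such pairings.
-/
lemma IsWeakGradient.aestronglyMeasurable_inner_grad [MeasurableSpace M] [BorelSpace M]
    [SecondCountableTopology M] {r : M → ℝ} {G : ∀ x : M, TangentSpace (𝓡 n) x}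
    (hG : IsWeakGradient r G) {f : M → ℝ} (hf : ContMDiff (𝓡 n) 𝓘(ℝ, ℝ) ∞ f) :
    AEStronglyMeasurable (fun x => (inner ℝ (G x) (grad f x) : ℝ)) (riemannianVolume n M) := by
  refine aestronglyMeasurable_of_source fun p => aestronglyMeasurable_source_of_chart p ?_
  set e := chartAt (EuclideanSpace ℝ (Fin n)) p with he
  have h1 : AEStronglyMeasurable (fun y => ∑ i, gradCoord f p y i *
      (inner ℝ (G (e.symm y)) (chartVector p y (EuclideanSpace.single i 1)) : ℝ))
      (volume.restrict e.target) := by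
    refine Finset.aestronglyMeasurable_fun_sum _ fun i _ => ?_
    refine AEStronglyMeasurable.mul ?_ (hG p (EuclideanSpace.single i 1)).1.aestronglyMeasurable
    exact ((EuclideanSpace.proj (𝕜 := ℝ) i).continuous.comp_continuousOn
      (continuousOn_gradCoord hf p)).aestronglyMeasurable e.open_target.measurableSet
  refine h1.congr ?_
  filter_upwards [ae_restrict_mem e.open_target.measurableSet] with y hy
  simp only [Function.comp_apply]
  rw [grad_eq_chartVector p hy (hf.mdifferentiable (by simp) _), chartVector_eq_sum, inner_sum]
  exact Finset.sum_congr rfl fun i _ => (real_inner_smul_right _ _ _).symm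

end Gradient

/-! ### Mollification in Euclidean space -/

section Mollification

open scoped Convolution
open Filter Metric

variable {E : Type*} [NormedAddCommGroup E] [InnerProductSpace ℝ E] [FiniteDimensional ℝ E]
  [MeasurableSpace E] [BorelSpace E]

/-- The directional derivative of a mollification, as the pairing with a translated bump. -/
lemma fderiv_normed_convolution_apply (φ : ContDiffBump (0 : E)) {r : E → ℝ}
    (hr : LocallyIntegrable r volume) (y w : E) :
    fderiv ℝ (φ.normed volume ⋆[ContinuousLinearMap.lsmul ℝ ℝ, volume] r) y w =
      -∫ t, r t * fderiv ℝ (fun t => φ.normed volume (y - t)) t w := by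
  have hcs := φ.hasCompactSupport_normed (μ := volume)
  have hsm : ContDiff ℝ 1 (φ.normed volume) := φ.contDiff_normed
  have h1 := (hcs.hasFDerivAt_convolution_left (ContinuousLinearMap.lsmul ℝ ℝ) hsm hr y).fderiv
  have hex := (hcs.fderiv ℝ).convolutionExists_left
    (ContinuousLinearMap.precompL E (ContinuousLinearMap.lsmul ℝ ℝ))
    (hsm.continuous_fderiv one_ne_zero) hr y
  rw [h1, convolution_eq_swap, ContinuousLinearMap.integral_apply hex.integrable_swap,
    ← integral_neg]
  refine integral_congr_ae (Eventually.of_forall fun t => ?_)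
  have h2 : HasFDerivAt (fun t => φ.normed volume (y - t))
      ((fderiv ℝ (φ.normed volume) (y - t)).comp (-ContinuousLinearMap.id ℝ E)) t :=
    HasFDerivAt.comp t (hsm.differentiable one_ne_zero _).hasFDerivAt
      ((hasFDerivAt_id t).const_sub y)
  simp only [h2.fderiv]
  simp [mul_comm]

/-- Mollification of a continuous function with locally bounded weak derivatives `g w` in the
directions `w`. -/
lemma exists_smooth_approx_of_weak_deriv {U K : Set E} (hU : IsOpen U) (hK : IsCompact K)
    (hKU : K ⊆ U) {r : E → ℝ} (hr : ContinuousOn r U) {g : E → E → ℝ}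
    (hgi : ∀ w, LocallyIntegrableOn (g w) U)
    (hg : ∀ w, ∀ ξ : E → ℝ, ContDiff ℝ ∞ ξ → HasCompactSupport ξ → tsupport ξ ⊆ U →
      ∫ y, r y * fderiv ℝ ξ y w = - ∫ y, g w y * ξ y)
    (hgb : ∀ w, ∀ L ⊆ U, IsCompact L → ∃ B : ℝ, ∀ᵐ y ∂volume.restrict L, |g w y| ≤ B) :
    ∃ R : ℕ → E → ℝ, (∀ k, ContDiff ℝ ∞ (R k)) ∧ TendstoUniformlyOn R r atTop K ∧
      (∀ w, ∀ᵐ y ∂volume.restrict K, Tendsto (fun k => fderiv ℝ (R k) y w) atTop (𝓝 (g w y))) ∧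
      ∀ w, ∃ B : ℝ, ∀ k, ∀ y ∈ K, |fderiv ℝ (R k) y w| ≤ B := by
  obtain ⟨δ, hδ, hδU⟩ := hK.exists_cthickening_subset_open hU hKU
  set K' := cthickening δ K with hK'
  have hK'c : IsCompact K' := hK.cthickening
  have hball : ∀ y ∈ K, closedBall y δ ⊆ K' := fun y hy => closedBall_subset_cthickening hy δ
  -- The outer radius tends to zero while its ratio to the inner one stays equal to 2, as almost
  -- everywhere convergence of the mollifications requires.
  let φ : ℕ → ContDiffBump (0 : E) := fun k =>
    ⟨δ / (2 * (k + 1)), δ / (k + 1), by positivity, by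
      apply div_lt_div_of_pos_left hδ <;> first | positivity | (have := k.cast_nonneg (α := ℝ); linarith)⟩
  have hout : ∀ k, (φ k).rOut = δ / (k + 1) := fun k => rfl
  have houtle : ∀ k, (φ k).rOut ≤ δ := fun k => by
    rw [hout]
    exact div_le_self hδ.le (by have := k.cast_nonneg (α := ℝ); linarith)
  have hlim : Tendsto (fun k => (φ k).rOut) atTop (𝓝 0) := by
    simp only [hout]
    have := (tendsto_one_div_add_atTop_nhds_zero_nat (𝕜 := ℝ)).const_mul δ
    simpa [div_eq_mul_inv] using this
  have hratio : ∀ k, (φ k).rOut ≤ 2 * (φ k).rIn := fun k => by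
    have : (φ k).rIn = δ / (2 * (k + 1)) := rfl
    rw [hout, this, mul_div_assoc', mul_div_mul_left _ _ two_ne_zero]
  -- Cutting off outside `K'` gives a globally integrable function, and mollification at points of
  -- `K` does not see the cut.
  set r' := K'.indicator r with hr'
  have hr'i : Integrable r' volume :=
    ((hr.mono hδU).integrableOn_compact hK'c).integrable_indicator hK'c.measurableSet
  have hg'i : ∀ w, Integrable (K'.indicator (g w)) volume := fun w =>
    ((hgi w).integrableOn_compact_subset hδU hK'c).integrable_indicator hK'c.measurableSet
  -- On `K`, differentiating the mollification mollifies the weak derivative: the translated bump is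
  -- an admissible test function in `hg`.
  have hderiv : ∀ w k, ∀ y ∈ K,
      fderiv ℝ ((φ k).normed volume ⋆[ContinuousLinearMap.lsmul ℝ ℝ, volume] r') y w =
        ((φ k).normed volume ⋆[ContinuousLinearMap.lsmul ℝ ℝ, volume] K'.indicator (g w)) y := by
    intro w k y hy
    rw [fderiv_normed_convolution_apply (φ k) hr'i.locallyIntegrable, convolution_eq_swap]
    set ξ : E → ℝ := fun t => (φ k).normed volume (y - t) with hξ
    have hsupp : tsupport ξ ⊆ K' := by
      refine (closure_minimal (fun t ht => ?_) isClosed_closedBall).trans (hball y hy)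
      have : y - t ∈ Function.support ((φ k).normed volume) := ht
      rw [(φ k).support_normed_eq, mem_ball_zero_iff] at this
      rw [mem_closedBall, dist_eq_norm']
      exact this.le.trans (houtle k)
    have hξs : ContDiff ℝ ∞ ξ := (φ k).contDiff_normed.comp (contDiff_const.sub contDiff_id)
    have hξc : HasCompactSupport ξ := hK'c.of_isClosed_subset (isClosed_tsupport _) hsupp
    have h1 := hg w ξ hξs hξc (hsupp.trans hδU)
    have h2 : ∀ t, r' t * fderiv ℝ ξ t w = r t * fderiv ℝ ξ t w := fun t => by
      by_cases ht : t ∈ K'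
      · simp [hr', ht]
      · have : fderiv ℝ ξ t = 0 := by
          by_contra h0
          exact ht (hsupp (support_fderiv_subset ℝ h0))
        simp [this]
    simp only [h2, h1, neg_neg]
    refine integral_congr_ae (Eventually.of_forall fun t => ?_)
    by_cases ht : t ∈ K'
    · simp [ht, hξ, mul_comm]
    · have : ξ t = 0 := by
        by_contra h0
        exact ht (hsupp (subset_tsupport _ h0))
      simp [ht, this]
  refine ⟨fun k => (φ k).normed volume ⋆[ContinuousLinearMap.lsmul ℝ ℝ, volume] r',
    fun k => (φ k).hasCompactSupport_normed.contDiff_convolution_left _ (φ k).contDiff_normed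
      hr'i.locallyIntegrable, ?_, fun w => ?_, fun w => ?_⟩
  · rw [Metric.tendstoUniformlyOn_iff]
    intro ε hε
    obtain ⟨η, hη, huc⟩ := Metric.uniformContinuousOn_iff.1
      (hK'c.uniformContinuousOn_of_continuous (hr.mono hδU)) (ε / 2) (by positivity)
    filter_upwards [hlim.eventually_lt_const hη] with k hk y hy
    have hyK' : y ∈ K' := hball y hy (mem_closedBall_self hδ.le)
    have h1 := (φ k).dist_normed_convolution_le (μ := volume) (g := r') (x₀ := y) (ε := ε / 2)
      hr'i.aestronglyMeasurable (fun x hx => by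
        have hxK' : x ∈ K' := hball y hy (ball_subset_closedBall
          (ball_subset_ball (houtle k) hx))
        simp only [hr', indicator_of_mem hxK', indicator_of_mem hyK']
        exact (huc x hxK' y hyK' ((mem_ball.1 hx).trans hk)).le)
    rw [dist_comm]
    have h2 : r' y = r y := indicator_of_mem hyK' r
    rw [h2] at h1
    linarith
  · have h1 := ContDiffBump.ae_convolution_tendsto_right_of_locallyIntegrable (μ := volume)
      hlim (Eventually.of_forall hratio) (hg'i w).locallyIntegrable
    filter_upwards [ae_restrict_of_ae h1, ae_restrict_mem hK.measurableSet] with y hy hyK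
    have hyK' : y ∈ K' := hball y hyK (mem_closedBall_self hδ.le)
    rw [indicator_of_mem hyK'] at hy
    exact hy.congr fun k => (hderiv w k y hyK).symm
  · obtain ⟨B, hB⟩ := hgb w K' hδU hK'c
    refine ⟨max B 0, fun k y hy => ?_⟩
    rw [hderiv w k y hy, convolution_eq_swap, ← Real.norm_eq_abs]
    have hint : Integrable (fun t => (φ k).normed volume (y - t)) volume :=
      ((φ k).integrable_normed (μ := volume)).comp_sub_left y
    -- The kernel is nonnegative with integral one, so averaging preserves the bound on the weak
    -- derivative.
    have h1 : ∫ t, (φ k).normed volume (y - t) * max B 0 = max B 0 := by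
      rw [integral_mul_const, integral_sub_left_eq_self ((φ k).normed volume) volume y,
        (φ k).integral_normed, one_mul]
    rw [← h1]
    refine norm_integral_le_of_norm_le (hint.mul_const _) ?_
    filter_upwards [(ae_restrict_iff' hK'c.measurableSet).1 hB] with t ht
    rw [ContinuousLinearMap.lsmul_apply, smul_eq_mul, norm_mul,
      Real.norm_of_nonneg ((φ k).nonneg_normed _)]
    refine mul_le_mul_of_nonneg_left ?_ ((φ k).nonneg_normed _)
    by_cases h : t ∈ K'
    · rw [indicator_of_mem h]
      exact (ht h).trans (le_max_left _ _)
    · rw [indicator_of_notMem h, norm_zero]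
      exact le_max_right _ _

end Mollification

/-! ### Integrability of products with compact support -/

section Integrability

/-- A product is continuous if the second factor is continuous with support in a closed subset of
an open set on which the first factor is continuous. -/
lemma continuous_mul_of_support_subset {X : Type*} [TopologicalSpace X] {a h : X → ℝ}
    {Ω K : Set X} (hΩ : IsOpen Ω) (ha : ContinuousOn a Ω) (hh : Continuous h) (hK : IsClosed K)
    (hsupp : Function.support h ⊆ K) (hKΩ : K ⊆ Ω) : Continuous fun x => a x * h x := by
  rw [continuous_iff_continuousAt]
  intro x
  by_cases hx : x ∈ K
  · exact (ha.continuousAt (hΩ.mem_nhds (hKΩ hx))).mul hh.continuousAt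
  · have : (fun x => a x * h x) =ᶠ[𝓝 x] fun _ => 0 := by
      filter_upwards [hK.isOpen_compl.mem_nhds hx] with z hz
      rw [Function.notMem_support.1 fun h0 => hz (hsupp h0), mul_zero]
    exact continuousAt_const.congr this.symm

variable {n : ℕ} {M : Type*} [TopologicalSpace M] [ChartedSpace (EuclideanSpace ℝ (Fin n)) M]
  [IsManifold (𝓡 n) ∞ M]
  [RiemannianBundle (fun x : M => TangentSpace (𝓡 n) x)]

lemma grad_eq_zero_of_notMem_tsupport {f : M → ℝ} {x : M} (hx : x ∉ tsupport f) :
    grad (n := n) f x = 0 := by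
  have h0 : f =ᶠ[𝓝 x] fun _ => (0 : ℝ) := notMem_tsupport_iff_eventuallyEq.1 hx
  refine ext_inner_right ℝ fun v => ?_
  rw [inner_grad_left, inner_zero_left]
  have : mvfderiv (𝓡 n) f x = mvfderiv (𝓡 n) (fun _ : M => (0 : ℝ)) x := by
    ext v
    have := h0.mfderiv_eq (I := 𝓡 n) (I' := 𝓘(ℝ, ℝ))
    exact congrArg (fun L : EuclideanSpace ℝ (Fin n) →L[ℝ] ℝ => L v) this
  rw [this, mvfderiv_const]
  rfl

lemma support_norm_grad_subset (f : M → ℝ) :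
    Function.support (fun x => ‖grad (n := n) f x‖) ⊆ tsupport f := fun x hx => by
  by_contra h
  exact hx (by simp [grad_eq_zero_of_notMem_tsupport (n := n) h])

lemma grad_sum {ι : Type*} (S : Finset ι) {f : ι → M → ℝ} {x : M}
    (hf : ∀ i, MDifferentiableAt (𝓡 n) 𝓘(ℝ, ℝ) (f i) x) :
    MDifferentiableAt (𝓡 n) 𝓘(ℝ, ℝ) (fun z => ∑ i ∈ S, f i z) x ∧
    grad (n := n) (fun z => ∑ i ∈ S, f i z) x = ∑ i ∈ S, grad (f i) x := by
  classical
  induction S using Finset.induction_on with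
  | empty =>
    simp only [Finset.sum_empty]
    refine ⟨mdifferentiableAt_const, ?_⟩
    refine ext_inner_right ℝ fun v => ?_
    rw [inner_grad_left, inner_zero_left, mvfderiv_const]
    rfl
  | insert i S hi ih =>
    simp only [Finset.sum_insert hi]
    refine ⟨(hf i).add ih.1, ?_⟩
    rw [← ih.2]
    refine ext_inner_right ℝ fun v => ?_
    rw [inner_add_left, inner_grad_left, inner_grad_left, inner_grad_left,
      mvfderiv_fun_add (hf i) ih.1]
    rfl

variable [IsContMDiffRiemannianBundle (𝓡 n) ∞ (EuclideanSpace ℝ (Fin n))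
      (fun x : M => TangentSpace (𝓡 n) x)]
  [MeasurableSpace M] [BorelSpace M]

lemma integrable_mul_of_tsupport_subset [T2Space M] {a f : M → ℝ} {Ω : Set M} (hΩ : IsOpen Ω)
    (ha : ContinuousOn a Ω) (hf : Continuous f) (hfc : HasCompactSupport f)
    (hfΩ : tsupport f ⊆ Ω) : Integrable (fun x => a x * f x) (riemannianVolume n M) :=
  (continuous_mul_of_support_subset hΩ ha hf (isClosed_tsupport f) (subset_tsupport f)
    hfΩ).integrable_of_hasCompactSupport hfc.mul_left

lemma integrable_mul_norm_grad [T2Space M] {a f : M → ℝ} {Ω : Set M} (hΩ : IsOpen Ω)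
    (ha : ContinuousOn a Ω) (hf : ContMDiff (𝓡 n) 𝓘(ℝ, ℝ) ∞ f) (hfc : HasCompactSupport f)
    (hfΩ : tsupport f ⊆ Ω) :
    Integrable (fun x => a x * ‖grad (n := n) f x‖) (riemannianVolume n M) :=
  (continuous_mul_of_support_subset hΩ ha (continuous_norm_grad hf) (isClosed_tsupport f)
    (support_norm_grad_subset f) hfΩ).integrable_of_hasCompactSupport
    (HasCompactSupport.mul_left (hfc.mono' (support_norm_grad_subset f)))

lemma integrable_mul_norm_grad_sq [T2Space M] {a f : M → ℝ} {Ω : Set M} (hΩ : IsOpen Ω)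
    (ha : ContinuousOn a Ω) (hf : ContMDiff (𝓡 n) 𝓘(ℝ, ℝ) ∞ f) (hfc : HasCompactSupport f)
    (hfΩ : tsupport f ⊆ Ω) :
    Integrable (fun x => a x * ‖grad (n := n) f x‖ ^ 2) (riemannianVolume n M) := by
  have hs : Function.support (fun x => ‖grad (n := n) f x‖ ^ 2) ⊆ tsupport f := fun x hx =>
    support_norm_grad_subset (n := n) f (fun h => hx (by simp only at h; simp [h]))
  exact (continuous_mul_of_support_subset hΩ ha ((continuous_norm_grad hf).pow 2)
    (isClosed_tsupport f) hs hfΩ).integrable_of_hasCompactSupport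
    (HasCompactSupport.mul_left (hfc.mono' hs))

variable [SecondCountableTopology M] {r : M → ℝ} {G : ∀ x : M, TangentSpace (𝓡 n) x}
  {γ : M → ℝ}

/-- Cauchy-Schwarz dominates the integrand by `|a| γ ‖∇f‖`, which is continuous with compact
support. Measurability of `a` is a separate assumption because `a` is continuous only on `Ω`. -/
lemma IsWeakGradient.integrable_mul_inner_grad [T2Space M] (hG : IsWeakGradient r G)
    (hγ : Continuous γ) (hGγ : ∀ᵐ x ∂riemannianVolume n M, ‖G x‖ = γ x)
    {a f : M → ℝ} {Ω : Set M} (hΩ : IsOpen Ω)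
    (ha : ContinuousOn a Ω) (ham : AEStronglyMeasurable a (riemannianVolume n M))
    (hf : ContMDiff (𝓡 n) 𝓘(ℝ, ℝ) ∞ f) (hfc : HasCompactSupport f) (hfΩ : tsupport f ⊆ Ω) :
    Integrable (fun x => a x * inner ℝ (G x) (grad f x)) (riemannianVolume n M) := by
  refine (integrable_mul_norm_grad hΩ (ha.abs.mul hγ.continuousOn) hf hfc hfΩ).mono'
    (ham.mul (hG.aestronglyMeasurable_inner_grad hf)) ?_
  filter_upwards [hGγ] with x hx
  rw [norm_mul, Real.norm_eq_abs, Pi.mul_apply, mul_assoc, ← hx]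
  exact mul_le_mul_of_nonneg_left (norm_inner_le_norm _ _) (abs_nonneg _)

/-- Here the compact support sits in the coefficient, as needed for `f = u`. -/
lemma IsWeakGradient.integrable_mul_inner_grad_of_hasCompactSupport [T2Space M]
    (hG : IsWeakGradient r G)
    (hγ : Continuous γ) (hGγ : ∀ᵐ x ∂riemannianVolume n M, ‖G x‖ = γ x)
    {a f : M → ℝ} (ha : Continuous a) (hac : HasCompactSupport a)
    (hf : ContMDiff (𝓡 n) 𝓘(ℝ, ℝ) ∞ f) :
    Integrable (fun x => a x * inner ℝ (G x) (grad f x)) (riemannianVolume n M) := by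
  have h1 : Integrable (fun x => |a x| * (γ x * ‖grad (n := n) f x‖)) (riemannianVolume n M) :=
    (ha.abs.mul (hγ.mul (continuous_norm_grad hf))).integrable_of_hasCompactSupport
      (HasCompactSupport.mul_right hac.norm)
  refine h1.mono' (ha.aestronglyMeasurable.mul (hG.aestronglyMeasurable_inner_grad hf)) ?_
  filter_upwards [hGγ] with x hx
  rw [norm_mul, Real.norm_eq_abs, ← hx]
  exact mul_le_mul_of_nonneg_left (norm_inner_le_norm _ _) (abs_nonneg _)

end Integrability

/-! ### Smooth approximation of a weakly differentiable function in a chart -/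

section ChartLimit

open Filter

variable {n : ℕ} {M : Type*} [TopologicalSpace M] [ChartedSpace (EuclideanSpace ℝ (Fin n)) M]
  [IsManifold (𝓡 n) ∞ M]
  [RiemannianBundle (fun x : M => TangentSpace (𝓡 n) x)]
  [IsContMDiffRiemannianBundle (𝓡 n) ∞ (EuclideanSpace ℝ (Fin n))
      (fun x : M => TangentSpace (𝓡 n) x)]
  [MeasurableSpace M] [BorelSpace M]
  {r : M → ℝ} {G : ∀ x : M, TangentSpace (𝓡 n) x} {γ : M → ℝ}

/-- Weak derivatives in a chart are locally bounded if the weak gradient is. -/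
lemma ae_abs_inner_chartVector_le (hγ : Continuous γ)
    (hGγ : ∀ᵐ x ∂riemannianVolume n M, ‖G x‖ = γ x) (p : M) (w : EuclideanSpace ℝ (Fin n))
    {L : Set (EuclideanSpace ℝ (Fin n))}
    (hLt : L ⊆ (chartAt (EuclideanSpace ℝ (Fin n)) p).target) (hL : IsCompact L) :
    ∃ B : ℝ, ∀ᵐ y ∂volume.restrict L,
      |inner ℝ (G ((chartAt (EuclideanSpace ℝ (Fin n)) p).symm y)) (chartVector p y w)| ≤ B := by
  set e := chartAt (EuclideanSpace ℝ (Fin n)) p with he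
  have hcont : ContinuousOn (fun y => γ (e.symm y) * ‖chartVector p y w‖) L := by
    refine (hγ.comp_continuousOn (e.continuousOn_symm.mono hLt)).mul ?_
    simp only [@norm_eq_sqrt_real_inner]
    exact (continuousOn_inner_chartVector p continuousOn_id continuousOn_const continuousOn_const
      fun x hx => hLt hx).sqrt
  obtain ⟨B, hB⟩ := hL.bddAbove_image hcont
  refine ⟨B, ?_⟩
  filter_upwards [ae_restrict_of_ae_restrict_of_subset hLt (ae_chart_of_ae p hGγ),
    ae_restrict_mem hL.measurableSet] with y hy hyL
  refine le_trans ?_ (hB ⟨y, hyL, rfl⟩)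
  simp only
  rw [← hy]
  exact abs_real_inner_le_norm _ _

/-- Approximation of a function with locally bounded weak gradient, near a compact subset of a
chart, by smooth functions. -/
lemma IsWeakGradient.exists_smooth_approx (hG : IsWeakGradient r G) (hr : Continuous r)
    (hγ : Continuous γ) (hGγ : ∀ᵐ x ∂riemannianVolume n M, ‖G x‖ = γ x) (p : M) {K : Set M}
    (hK : IsCompact K) (hKm : MeasurableSet K)
    (hKs : K ⊆ (chartAt (EuclideanSpace ℝ (Fin n)) p).source) :
    ∃ R : ℕ → M → ℝ,
      (∀ k, ContMDiffOn (𝓡 n) 𝓘(ℝ, ℝ) ∞ (R k)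
        (chartAt (EuclideanSpace ℝ (Fin n)) p).source) ∧
      TendstoUniformlyOn R r atTop K ∧
      (∀ᵐ x ∂(riemannianVolume n M).restrict K,
        Tendsto (fun k => (inner ℝ (G x) (grad (R k) x) : ℝ)) atTop (𝓝 (γ x ^ 2))) ∧
      ∃ B : ℝ, ∀ᵐ x ∂(riemannianVolume n M).restrict K, ∀ k,
        |inner ℝ (G x) (grad (R k) x)| ≤ B * γ x := by
  set e := chartAt (EuclideanSpace ℝ (Fin n)) p with he
  have hK' : IsCompact (e '' K) := hK.image_of_continuousOn (e.continuousOn.mono hKs)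
  have hK't : e '' K ⊆ e.target := by
    rintro _ ⟨x, hx, rfl⟩
    exact e.map_source (hKs hx)
  obtain ⟨R, hRs, hRu, hRd, hRb⟩ := exists_smooth_approx_of_weak_deriv (r := r ∘ e.symm)
    (g := fun w y => inner ℝ (G (e.symm y)) (chartVector p y w)) e.open_target hK' hK't
    (hr.comp_continuousOn e.continuousOn_symm) (fun w => (hG p w).1) (fun w => (hG p w).2)
    (fun w L hLt hL => ae_abs_inner_chartVector_le hγ hGγ p w hLt hL)
  have hRe : ∀ k, ContMDiffOn (𝓡 n) 𝓘(ℝ, ℝ) ∞ (R k ∘ e) e.source := fun k =>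
    (hRs k).contMDiff.comp_contMDiffOn (contMDiffOn_chart (I := 𝓡 n))
  choose B hB using hRb
  obtain ⟨c, hc0, hc⟩ := exists_norm_le_norm_chartVector p hK' hK't
  have hinner : ∀ k, ∀ y ∈ e.target, ∀ v, inner ℝ (chartVector p y v)
      (grad (R k ∘ e) (e.symm y)) =
        ∑ i, v i * fderiv ℝ (R k) y (EuclideanSpace.single i 1) := by
    intro k y hy v
    have hd : MDifferentiableAt (𝓡 n) 𝓘(ℝ, ℝ) (R k ∘ e) (e.symm y) :=
      ((hRe k).contMDiffAt (e.open_source.mem_nhds (e.map_target hy))).mdifferentiableAt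
        (by simp)
    rw [inner_grad_right, mvfderiv_chartVector p hy hd]
    have h1 : (R k ∘ e) ∘ e.symm =ᶠ[𝓝 y] R k := by
      filter_upwards [e.open_target.mem_nhds hy] with z hz
      simp [e.right_inv hz]
    rw [h1.fderiv_eq]
    conv_lhs => rw [eq_sum_single v, map_sum]
    simp only [map_smul, smul_eq_mul]
  -- Quantifying over `y` with `e.symm y = x` lets `x` be substituted later, avoiding transport
  -- between tangent spaces.
  have hae : ∀ᵐ x ∂(riemannianVolume n M).restrict K, ∀ i : Fin n,
      ∀ y ∈ e.target, e.symm y = x →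
      Tendsto (fun k => fderiv ℝ (R k) y (EuclideanSpace.single i 1)) atTop
        (𝓝 (inner ℝ (G (e.symm y)) (chartVector p y (EuclideanSpace.single i 1)))) := by
    rw [ae_all_iff]
    intro i
    have h1 : ∀ᵐ y ∂volume.restrict e.target, y ∈ e '' K →
        Tendsto (fun k => fderiv ℝ (R k) y (EuclideanSpace.single i 1)) atTop
        (𝓝 (inner ℝ (G (e.symm y)) (chartVector p y (EuclideanSpace.single i 1)))) :=
      ae_restrict_of_ae ((ae_restrict_iff' hK'.measurableSet).1 (hRd _))
    obtain ⟨h2, h3⟩ := chartAt_map_absolutelyContinuous (n := n) p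
    have h4 := ae_restrict_of_ae_restrict_of_subset hKs (ae_of_ae_map h2 (h3.ae_le h1))
    filter_upwards [h4, ae_restrict_mem hKm] with x hx hxK y hy hyx
    obtain rfl : e x = y := by rw [← hyx, e.right_inv hy]
    exact hx ⟨x, hxK, rfl⟩
  refine ⟨fun k => R k ∘ e, hRe, ?_, ?_, c * ∑ i, |B (EuclideanSpace.single i 1)|, ?_⟩
  · rw [Metric.tendstoUniformlyOn_iff] at hRu ⊢
    intro ε hε
    filter_upwards [hRu ε hε] with k hk x hx
    have := hk (e x) ⟨x, hx, rfl⟩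
    simpa [e.left_inv (hKs hx)] using this
  -- If `v` is the coordinate vector of `G`, then `⟨G, ∇R_k⟩ = ∑ v_i ∂_i R_k` tends to `∑ v_i ⟨G,
  -- ∂_i⟩ = |G|²`.
  · filter_upwards [hae, ae_restrict_of_ae hGγ, ae_restrict_mem hKm] with x hx hGx hxK
    obtain ⟨y, hy, rfl⟩ : ∃ y ∈ e.target, e.symm y = x :=
      ⟨e x, e.map_source (hKs hxK), e.left_inv (hKs hxK)⟩
    obtain ⟨v, hv⟩ := (chartVector_bijective p hy).2 (G (e.symm y))
    rw [← hGx, ← real_inner_self_eq_norm_sq]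
    have h1 : inner ℝ (G (e.symm y)) (G (e.symm y)) = ∑ i, v i *
        (inner ℝ (G (e.symm y)) (chartVector p y (EuclideanSpace.single i 1)) : ℝ) := by
      conv_lhs => rw [← hv]
      rw [chartVector_eq_sum p y v, inner_sum, ← chartVector_eq_sum p y v, hv]
      exact Finset.sum_congr rfl fun i _ => real_inner_smul_right _ _ _
    rw [h1, ← hv]
    simp only [hinner _ y hy]
    rw [hv]
    exact tendsto_finsetSum _ fun i _ => (hx i y hy rfl).const_mul _
  · filter_upwards [ae_restrict_of_ae hGγ, ae_restrict_mem hKm] with x hGx hxK k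
    obtain ⟨y, hy, rfl⟩ : ∃ y ∈ e.target, e.symm y = x :=
      ⟨e x, e.map_source (hKs hxK), e.left_inv (hKs hxK)⟩
    have hyK : y ∈ e '' K := ⟨_, hxK, e.right_inv hy⟩
    obtain ⟨v, hv⟩ := (chartVector_bijective p hy).2 (G (e.symm y))
    rw [← hGx, ← hv, hinner k y hy]
    calc |∑ i, v i * fderiv ℝ (R k) y (EuclideanSpace.single i 1)|
        ≤ ∑ i, |v i * fderiv ℝ (R k) y (EuclideanSpace.single i 1)| :=
          Finset.abs_sum_le_sum_abs _ _
      _ ≤ ∑ i, ‖v‖ * |B (EuclideanSpace.single i 1)| := by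
          refine Finset.sum_le_sum fun i _ => ?_
          rw [abs_mul]
          exact mul_le_mul (PiLp.norm_apply_le v i)
            ((hB _ k y hyK).trans (le_abs_self _)) (abs_nonneg _) (norm_nonneg _)
      _ = ‖v‖ * ∑ i, |B (EuclideanSpace.single i 1)| := by rw [Finset.mul_sum]
      _ ≤ (c * ‖chartVector p y v‖) * ∑ i, |B (EuclideanSpace.single i 1)| :=
          mul_le_mul_of_nonneg_right (hc y hyK v) (Finset.sum_nonneg fun i _ => abs_nonneg _)
      _ = _ := by ring

end ChartLimit

/-! ### Admitting powers of the distance-like function in test functions -/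

section TestIntegrand

open Filter

variable {n : ℕ} {M : Type*} [TopologicalSpace M] [ChartedSpace (EuclideanSpace ℝ (Fin n)) M]
  [RiemannianBundle (fun x : M => TangentSpace (𝓡 n) x)]

/-- The integrand of `∫ a ⟨G, ∇ζ⟩ + b ζ` for `ζ = r ^ β ψ`, where `G` is the weak gradient of `r`
and has norm `γ`. -/
def testIntegrand (r : M → ℝ) (G : ∀ x : M, TangentSpace (𝓡 n) x) (γ a b : M → ℝ) (β : ℝ)
    (ψ : M → ℝ) (x : M) : ℝ :=
  r x ^ β * (a x * inner ℝ (G x) (grad ψ x) + b x * ψ x) +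
    β * r x ^ (β - 1) * (a x * γ x ^ 2) * ψ x

variable [IsManifold (𝓡 n) ∞ M]
  [IsContMDiffRiemannianBundle (𝓡 n) ∞ (EuclideanSpace ℝ (Fin n))
      (fun x : M => TangentSpace (𝓡 n) x)]
  [MeasurableSpace M] [BorelSpace M] [T2Space M] [SecondCountableTopology M]
  {r : M → ℝ} {G : ∀ x : M, TangentSpace (𝓡 n) x} {γ a b : M → ℝ}

lemma continuousOn_rpow_const_of_ne_zero (hr : Continuous r) (β : ℝ) :
    ContinuousOn (fun x => r x ^ β) {x | r x ≠ 0} :=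
  hr.continuousOn.rpow_const fun _ hx => Or.inl hx

lemma isOpen_ne_zero (hr : Continuous r) : IsOpen {x | r x ≠ 0} :=
  isOpen_ne_fun hr continuous_const

lemma IsWeakGradient.integrable_testIntegrand (hG : IsWeakGradient r G) (hr : Continuous r)
    (hγ : Continuous γ) (hGγ : ∀ᵐ x ∂riemannianVolume n M, ‖G x‖ = γ x) (ha : Continuous a)
    (hb : ContinuousOn b {x | r x ≠ 0}) (β : ℝ) {ψ : M → ℝ}
    (hψ : IsTestFunction (n := n) {x | r x ≠ 0} ψ) :
    Integrable (testIntegrand r G γ a b β ψ) (riemannianVolume n M) := by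
  obtain ⟨h1, h2, h3⟩ := hψ
  have hΩ := isOpen_ne_zero hr
  have hc := continuousOn_rpow_const_of_ne_zero hr
  have i1 := hG.integrable_mul_inner_grad hγ hGγ hΩ ((hc β).mul ha.continuousOn)
    ((hr.measurable.pow_const β).aestronglyMeasurable.mul ha.aestronglyMeasurable) h1 h2 h3
  have i2 := integrable_mul_of_tsupport_subset (n := n) hΩ ((hc β).mul hb) h1.continuous h2 h3
  have i3 := integrable_mul_of_tsupport_subset (n := n) hΩ
    ((continuousOn_const (c := β)).mul (hc (β - 1)) |>.mul (ha.mul (hγ.pow 2)).continuousOn)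
    h1.continuous h2 h3
  refine ((i1.add i2).add i3).congr (Eventually.of_forall fun x => ?_)
  simp only [Pi.add_apply, Pi.mul_apply, Pi.pow_apply, testIntegrand]
  ring

/-- Apply `hJ` to the smooth functions `R_k ^ β ψ`, with `R_k` the mollifications of `r` in the
chart, and pass to the limit by dominated convergence. -/
lemma testIntegrand_nonneg_of_tsupport_subset_source (hG : IsWeakGradient r G)
    (hr : Continuous r) (hr0 : ∀ x, 0 ≤ r x)
    (hγ : Continuous γ) (hGγ : ∀ᵐ x ∂riemannianVolume n M, ‖G x‖ = γ x) (ha : Continuous a)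
    (hb : ContinuousOn b {x | r x ≠ 0}) (s β : ℝ)
    (hJ : ∀ ζ : M → ℝ, IsTestFunction (n := n) {x | r x ≠ 0} ζ → (∀ x, 0 ≤ ζ x) →
      0 ≤ s * ∫ x, a x * inner ℝ (G x) (grad ζ x) + b x * ζ x ∂riemannianVolume n M)
    {ψ : M → ℝ} (hψ : IsTestFunction (n := n) {x | r x ≠ 0} ψ) (hψ0 : ∀ x, 0 ≤ ψ x) (p : M)
    (hp : tsupport ψ ⊆ (chartAt (EuclideanSpace ℝ (Fin n)) p).source) :
    0 ≤ s * ∫ x, testIntegrand r G γ a b β ψ x ∂riemannianVolume n M := by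
  obtain ⟨hψ1, hψ2, hψ3⟩ := hψ
  have hΩ := isOpen_ne_zero hr
  set K := tsupport ψ with hK
  have hKc : IsCompact K := hψ2
  have hKm : MeasurableSet K := (isClosed_tsupport ψ).measurableSet
  obtain ⟨R, hRs, hRu, hRd, B, hRb⟩ := hG.exists_smooth_approx hr hγ hGγ p hKc hKm hp
  obtain ⟨c, hc, hcr⟩ := hKc.exists_forall_le' (a := 0) hr.continuousOn
    fun x hx => lt_of_le_of_ne (hr0 x) (Ne.symm (hψ3 hx))
  obtain ⟨m, hm⟩ := hKc.bddAbove_image hr.continuousOn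
  -- On `K` one has `c ≤ r ≤ m`, so an approximation within `c / 2` takes values in this interval,
  -- away from the singularity of `t ^ β`.
  have hpos : ∀ t ∈ Icc (c / 2) (m + c / 2), 0 < t := fun t ht => (half_pos hc).trans_le ht.1
  have hbound : ∀ q : ℝ, ∃ D, ∀ t ∈ Icc (c / 2) (m + c / 2), ‖t ^ q‖ ≤ D := fun q =>
    isCompact_Icc.exists_bound_of_continuousOn
      (continuousOn_id.rpow_const fun t ht => Or.inl (hpos t ht).ne')
  obtain ⟨D₁, hD₁⟩ := hbound β
  obtain ⟨D₂, hD₂⟩ := hbound (β - 1)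
  have hRI : ∀ᶠ k in atTop, ∀ x ∈ K, R k x ∈ Icc (c / 2) (m + c / 2) := by
    filter_upwards [Metric.tendstoUniformlyOn_iff.1 hRu (c / 2) (half_pos hc)] with k hk x hx
    have h1 := abs_lt.1 (Real.dist_eq (r x) (R k x) ▸ hk x hx)
    have h2 := hcr x hx
    have h3 : r x ≤ m := hm ⟨x, hx, rfl⟩
    constructor <;> linarith [h1.1, h1.2]
  set ζ : ℕ → M → ℝ := fun k x => R k x ^ β * ψ x with hζ
  have hsub : ∀ k, tsupport (ζ k) ⊆ K := fun k => tsupport_mul_subset_right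
  have hRat : ∀ k, ∀ x ∈ K, ContMDiffAt (𝓡 n) 𝓘(ℝ, ℝ) ∞ (R k) x := fun k x hx =>
    (hRs k).contMDiffAt ((chartAt (EuclideanSpace ℝ (Fin n)) p).open_source.mem_nhds (hp hx))
  have hζt : ∀ᶠ k in atTop, IsTestFunction (n := n) {x | r x ≠ 0} (ζ k) ∧ ∀ x, 0 ≤ ζ k x := by
    filter_upwards [hRI] with k hk
    refine ⟨⟨contMDiff_of_tsupport fun x hx => ?_, hψ2.mul_left, (hsub k).trans hψ3⟩, fun x => ?_⟩
    · have hxK := hsub k hx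
      have h1 : ContDiffAt ℝ ∞ (fun t : ℝ => t ^ β) (R k x) :=
        Real.contDiffAt_rpow_const_of_ne (hpos _ (hk x hxK)).ne'
      exact (h1.contMDiffAt.comp x (hRat k x hxK)).mul hψ1.contMDiffAt
    · by_cases hx : x ∈ K
      · exact mul_nonneg (Real.rpow_nonneg (hpos _ (hk x hx)).le _) (hψ0 x)
      · simp [hζ, image_eq_zero_of_notMem_tsupport hx]
  have hzero : ∀ k, ∀ x ∉ K, a x * inner ℝ (G x) (grad (n := n) (ζ k) x) + b x * ζ k x = 0 := by
    intro k x hx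
    rw [grad_eq_zero_of_notMem_tsupport fun h => hx (hsub k h), inner_zero_right,
      image_eq_zero_of_notMem_tsupport fun h => hx (hsub k h)]
    ring
  have hformula : ∀ᶠ k in atTop, ∀ x ∈ K,
      a x * inner ℝ (G x) (grad (n := n) (ζ k) x) + b x * ζ k x =
        R k x ^ β * (a x * inner ℝ (G x) (grad ψ x) + b x * ψ x) +
          β * R k x ^ (β - 1) * (a x * inner ℝ (G x) (grad (R k) x)) * ψ x := by
    filter_upwards [hRI] with k hk x hx
    have h1 : HasDerivAt (fun t : ℝ => t ^ β) (β * R k x ^ (β - 1)) (R k x) :=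
      Real.hasDerivAt_rpow_const (Or.inl (hpos _ (hk x hx)).ne')
    have h2 : MDifferentiableAt (𝓡 n) 𝓘(ℝ, ℝ) (R k) x :=
      (hRat k x hx).mdifferentiableAt (by simp)
    have h3 : MDifferentiableAt (𝓡 n) 𝓘(ℝ, ℝ) (fun z => R k z ^ β) x :=
      MDifferentiableAt.comp (g := fun t : ℝ => t ^ β) x
        h1.differentiableAt.mdifferentiableAt h2
    rw [hζ, grad_mul h3 (hψ1.mdifferentiable (by simp) x), grad_comp h2 h1, inner_add_right,
      real_inner_smul_right, real_inner_smul_right, real_inner_smul_right]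
    ring
  have hlim : Tendsto (fun k => ∫ x, a x * inner ℝ (G x) (grad (n := n) (ζ k) x) + b x * ζ k x
      ∂riemannianVolume n M) atTop
      (𝓝 (∫ x, testIntegrand r G γ a b β ψ x ∂riemannianVolume n M)) := by
    refine tendsto_integral_filter_of_dominated_convergence
      -- One summand for each term of `hformula`; the last uses the bound `|⟨G, ∇R_k⟩| ≤ |B| γ`,
      -- uniform in `k`.
      (fun x => D₁ * ((|a x| * γ x) * ‖grad (n := n) ψ x‖) + D₁ * ‖b x * ψ x‖ +
        |β| * D₂ * |B| * ‖(a x * γ x) * ψ x‖) ?_ ?_ ?_ ?_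
    · filter_upwards [hζt] with k hk
      exact (hG.integrable_mul_inner_grad hγ hGγ hΩ ha.continuousOn ha.aestronglyMeasurable
        hk.1.1 hk.1.2.1 hk.1.2.2).aestronglyMeasurable.add (integrable_mul_of_tsupport_subset
          hΩ hb hk.1.1.continuous hk.1.2.1 hk.1.2.2).aestronglyMeasurable
    · filter_upwards [hRI, hformula] with k hk hkf
      filter_upwards [hGγ, (ae_restrict_iff' hKm).1 hRb] with x hGx hBx
      have hγ0 : 0 ≤ γ x := hGx ▸ norm_nonneg _
      by_cases hx : x ∈ K
      · have hD₁x := hD₁ _ (hk x hx)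
        have hD₂x := hD₂ _ (hk x hx)
        have hD₁0 : 0 ≤ D₁ := (norm_nonneg _).trans hD₁x
        have hD₂0 : 0 ≤ D₂ := (norm_nonneg _).trans hD₂x
        rw [hkf x hx, mul_add]
        refine (norm_add₃_le).trans (add_le_add (add_le_add ?_ ?_) ?_)
        · rw [norm_mul, norm_mul, mul_assoc |a x|, ← hGx]
          gcongr
          · exact le_rfl
          · exact norm_inner_le_norm _ _
        · rw [norm_mul]
          gcongr
        · have h1 : |inner ℝ (G x) (grad (n := n) (R k) x)| ≤ |B| * γ x :=
            (hBx hx k).trans (mul_le_mul_of_nonneg_right (le_abs_self B) hγ0)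
          have h2 : ‖a x * γ x * ψ x‖ = |a x| * γ x * |ψ x| := by
            rw [norm_mul, norm_mul, Real.norm_of_nonneg hγ0]
            rfl
          rw [h2, norm_mul, norm_mul, norm_mul, norm_mul]
          calc ‖β‖ * ‖R k x ^ (β - 1)‖ * (‖a x‖ * ‖inner ℝ (G x) (grad (n := n) (R k) x)‖) * ‖ψ x‖
              ≤ |β| * D₂ * (|a x| * (|B| * γ x)) * |ψ x| := by
                simp only [Real.norm_eq_abs] at hD₂x ⊢
                gcongr
            _ = _ := by ring
      · rw [hzero k x hx, norm_zero, image_eq_zero_of_notMem_tsupport hx,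
          grad_eq_zero_of_notMem_tsupport hx]
        simp
    · exact (((integrable_mul_norm_grad hΩ (ha.abs.mul hγ).continuousOn hψ1 hψ2 hψ3).const_mul
        D₁).add ((integrable_mul_of_tsupport_subset hΩ hb hψ1.continuous hψ2 hψ3).norm.const_mul
        D₁)).add ((integrable_mul_of_tsupport_subset hΩ (ha.mul hγ).continuousOn hψ1.continuous
        hψ2 hψ3).norm.const_mul _)
    · filter_upwards [(ae_restrict_iff' hKm).1 hRd] with x hRx
      by_cases hx : x ∈ K
      · have h1 : Tendsto (fun k => R k x) atTop (𝓝 (r x)) := hRu.tendsto_at hx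
        have h2 : ∀ q : ℝ, Tendsto (fun k => R k x ^ q) atTop (𝓝 (r x ^ q)) := fun q =>
          h1.rpow_const (Or.inl (hψ3 hx))
        have h3 := ((h2 β).mul_const (a x * inner ℝ (G x) (grad (n := n) ψ x) + b x * ψ x)).add
          ((((h2 (β - 1)).const_mul β).mul ((hRx hx).const_mul (a x))).mul_const (ψ x))
        refine h3.congr' ?_
        filter_upwards [hformula] with k hk
        exact (hk x hx).symm
      · have h1 : testIntegrand r G γ a b β ψ x = 0 := by
          rw [testIntegrand, image_eq_zero_of_notMem_tsupport hx,
            grad_eq_zero_of_notMem_tsupport hx, inner_zero_right]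
          ring
        simp only [hzero _ x hx, h1]
        exact tendsto_const_nhds
  refine ge_of_tendsto (hlim.const_mul s) ?_
  filter_upwards [hζt] with k hk
  exact hJ _ hk.1 hk.2

/-- The weak inequality `0 ≤ s ∫ a ⟨G, ∇ζ⟩ + b ζ` extends from smooth `ζ` to `ζ = r ^ β ψ`. -/
lemma testIntegrand_nonneg (hG : IsWeakGradient r G)
    (hr : Continuous r) (hr0 : ∀ x, 0 ≤ r x)
    (hγ : Continuous γ) (hGγ : ∀ᵐ x ∂riemannianVolume n M, ‖G x‖ = γ x) (ha : Continuous a)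
    (hb : ContinuousOn b {x | r x ≠ 0}) (s β : ℝ)
    (hJ : ∀ ζ : M → ℝ, IsTestFunction (n := n) {x | r x ≠ 0} ζ → (∀ x, 0 ≤ ζ x) →
      0 ≤ s * ∫ x, a x * inner ℝ (G x) (grad ζ x) + b x * ζ x ∂riemannianVolume n M)
    {ψ : M → ℝ} (hψ : IsTestFunction (n := n) {x | r x ≠ 0} ψ) (hψ0 : ∀ x, 0 ≤ ψ x) :
    0 ≤ s * ∫ x, testIntegrand r G γ a b β ψ x ∂riemannianVolume n M := by
  have : LocallyCompactSpace M := ChartedSpace.locallyCompactSpace (EuclideanSpace ℝ (Fin n)) M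
  obtain ⟨f, hf⟩ := SmoothPartitionOfUnity.exists_isSubordinate (𝓡 n) (isClosed_univ (X := M))
    (fun p : M => (chartAt (EuclideanSpace ℝ (Fin n)) p).source)
    (fun p => (chartAt (EuclideanSpace ℝ (Fin n)) p).open_source)
    (fun p _ => mem_iUnion.2 ⟨p, mem_chart_source _ p⟩)
  have hfin := f.locallyFinite.finite_nonempty_inter_compact hψ.2.1.isCompact
  set S := hfin.toFinset with hS
  set ψ' : M → M → ℝ := fun p x => f p x * ψ x with hψ'
  have hψ't : ∀ p, IsTestFunction (n := n) {x | r x ≠ 0} (ψ' p) := fun p =>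
    ⟨(f p).contMDiff.mul hψ.1, hψ.2.1.mul_left, tsupport_mul_subset_right.trans hψ.2.2⟩
  have hsum : ψ = fun x => ∑ p ∈ S, ψ' p x := by
    ext x
    rw [hψ', ← Finset.sum_mul]
    by_cases hx : x ∈ tsupport ψ
    · have h1 : ∑ p ∈ S, f p x = 1 := by
        rw [← f.sum_eq_one (mem_univ x)]
        refine (finsum_eq_sum_of_support_subset _ fun p hp => ?_).symm
        rw [hS, Finite.coe_toFinset]
        exact ⟨x, hp, hx⟩
      rw [h1, one_mul]
    · rw [image_eq_zero_of_notMem_tsupport hx, mul_zero]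
  -- The integrand is linear in `ψ`, so the partition of unity reduces the claim to functions
  -- supported in one chart.
  have hT : ∀ x, testIntegrand r G γ a b β ψ x = ∑ p ∈ S, testIntegrand r G γ a b β (ψ' p) x := by
    intro x
    have h1 : grad (n := n) ψ x = ∑ p ∈ S, grad (ψ' p) x := by
      conv_lhs => rw [hsum]
      exact (grad_sum S fun p => (hψ't p).1.mdifferentiable (by simp) x).2
    have h2 : ψ x = ∑ p ∈ S, ψ' p x := congrFun hsum x
    simp only [testIntegrand]
    rw [h1, inner_sum, h2, Finset.sum_add_distrib, ← Finset.mul_sum, ← Finset.mul_sum,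
      Finset.sum_add_distrib, ← Finset.mul_sum, ← Finset.mul_sum]
  simp only [hT]
  rw [integral_finsetSum _ fun p _ => hG.integrable_testIntegrand hr hγ hGγ ha hb β (hψ't p),
    Finset.mul_sum]
  exact Finset.sum_nonneg fun p _ => testIntegrand_nonneg_of_tsupport_subset_source hG hr hr0 hγ
    hGγ ha hb s β hJ (hψ't p) (fun x => mul_nonneg (f.nonneg p x) (hψ0 x)) p
    (tsupport_mul_subset_left.trans (hf p))

end TestIntegrand

/-! ### Divergence form and the Hardy inequality -/

section Hardy

open Filter

variable {n : ℕ} {M : Type*} [TopologicalSpace M] [ChartedSpace (EuclideanSpace ℝ (Fin n)) M]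

lemma weight_pos (u : M → ℝ) (x : M) : 0 < weight u x := Real.exp_pos _

lemma weight_rpow (u : M → ℝ) (c : ℝ) (x : M) : weight u x ^ c = Real.exp (c * u x) := by
  rw [weight, ← Real.exp_mul, mul_comm]

lemma continuous_weight_rpow {u : M → ℝ} (hu : Continuous u) (c : ℝ) :
    Continuous fun x => weight u x ^ c := by
  simp only [weight_rpow]
  exact Real.continuous_exp.comp (continuous_const.mul hu)

lemma contMDiff_weight_rpow {u : M → ℝ} (hu : ContMDiff (𝓡 n) 𝓘(ℝ, ℝ) ∞ u) (c : ℝ) :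
    ContMDiff (𝓡 n) 𝓘(ℝ, ℝ) ∞ fun x => weight u x ^ c := by
  simp only [weight_rpow]
  exact Real.contDiff_exp.contMDiff.comp (contMDiff_const.mul hu)

variable [RiemannianBundle (fun x : M => TangentSpace (𝓡 n) x)]

lemma grad_weight_rpow {u : M → ℝ} (hu : ContMDiff (𝓡 n) 𝓘(ℝ, ℝ) ∞ u) (c : ℝ) (x : M) :
    grad (n := n) (fun z => weight u z ^ c) x = (c * weight u x ^ c) • grad u x := by
  simp only [weight_rpow]
  have h : HasDerivAt (fun t : ℝ => Real.exp (c * t)) (c * Real.exp (c * u x)) (u x) := by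
    simpa [mul_comm] using ((hasDerivAt_id (u x)).const_mul c).exp
  exact grad_comp (hu.mdifferentiable (by simp) x) h

variable [IsManifold (𝓡 n) ∞ M]
  [IsContMDiffRiemannianBundle (𝓡 n) ∞ (EuclideanSpace ℝ (Fin n))
      (fun x : M => TangentSpace (𝓡 n) x)]
  [MeasurableSpace M] [BorelSpace M] [T2Space M] [SecondCountableTopology M]
  {r : M → ℝ} {G : ∀ x : M, TangentSpace (𝓡 n) x} {γ : M → ℝ}

/-- The affine Laplacian is in divergence form: its pairing with `V^τ ζ` is
`-∫ V^(τ+μ-λ) ⟨G, ∇ζ⟩`. -/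
lemma affineLaplacianPairing_weight_rpow_mul (hG : IsWeakGradient r G) (hγ : Continuous γ)
    (hGγ : ∀ᵐ x ∂riemannianVolume n M, ‖G x‖ = γ x) {u : M → ℝ}
    (hu : ContMDiff (𝓡 n) 𝓘(ℝ, ℝ) ∞ u) {lam mu tau : ℝ} (htau : tau = (n + 1) * lam + mu)
    {ζ : M → ℝ} (hζ : ContMDiff (𝓡 n) 𝓘(ℝ, ℝ) ∞ ζ) (hζc : HasCompactSupport ζ) :
    affineLaplacianPairing u lam mu G (fun x => weight u x ^ tau * ζ x) =
      -∫ x, weight u x ^ (tau + mu - lam) * inner ℝ (G x) (grad ζ x) ∂riemannianVolume n M := by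
  have hw : ∀ x, weight u x ^ (mu - lam) * weight u x ^ tau = weight u x ^ (tau + mu - lam) :=
    fun x => by rw [← Real.rpow_add (weight_pos u x)]; ring_nf
  have hcont := continuous_weight_rpow hu.continuous (tau + mu - lam)
  have hgrad : ∀ x, inner ℝ (G x)
      (grad (n := n) (fun z => weight u z ^ (mu - lam) * (weight u z ^ tau * ζ z)) x) =
      weight u x ^ (tau + mu - lam) * inner ℝ (G x) (grad ζ x) +
        ((tau + mu - lam) * weight u x ^ (tau + mu - lam) * ζ x) *
          inner ℝ (G x) (grad u x) := by
    intro x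
    simp only [← mul_assoc, hw]
    rw [grad_mul ((contMDiff_weight_rpow hu _).mdifferentiable (by simp) x)
      (hζ.mdifferentiable (by simp) x), grad_weight_rpow hu, inner_add_right,
      real_inner_smul_right, real_inner_smul_right, real_inner_smul_right]
    ring
  have i1 := hG.integrable_mul_inner_grad hγ hGγ isOpen_univ hcont.continuousOn
    hcont.aestronglyMeasurable hζ hζc (subset_univ _)
  have i2 := hG.integrable_mul_inner_grad_of_hasCompactSupport hγ hGγ
    (a := fun x => (tau + mu - lam) * weight u x ^ (tau + mu - lam) * ζ x)
    ((continuous_const.mul hcont).mul hζ.continuous) hζc.mul_left hu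
  -- The value of `τ` gives `τ + μ - λ = 2μ + nλ`: the drift term cancels the term in which the
  -- gradient falls on the weight.
  have h2 : ∀ x, weight u x ^ (mu - lam) * ((2 * mu + n * lam) * inner ℝ (grad u x) (G x)) *
      (weight u x ^ tau * ζ x) = ((tau + mu - lam) * weight u x ^ (tau + mu - lam) * ζ x) *
          inner ℝ (G x) (grad u x) := by
    intro x
    rw [← hw x, real_inner_comm (G x), htau]
    ring
  rw [affineLaplacianPairing]
  simp only [hgrad, h2]
  rw [integral_add i1 i2]
  ring

/-- The right side is the defect in the differential inequality tested against `V^τ ζ`, so its sign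
is known when `ζ ≥ 0`. The left side has the form required by `testIntegrand_nonneg`. -/
lemma integral_mul_inner_grad_add (hG : IsWeakGradient r G) (hr : Continuous r)
    (hγ : Continuous γ)
    (hGγ : ∀ᵐ x ∂riemannianVolume n M, ‖G x‖ = γ x) {u : M → ℝ}
    (hu : ContMDiff (𝓡 n) 𝓘(ℝ, ℝ) ∞ u) {lam mu tau : ℝ} (htau : tau = (n + 1) * lam + mu)
    (C : ℝ) {ζ : M → ℝ} (hζ : IsTestFunction (n := n) {x | r x ≠ 0} ζ) :
    IsTestFunction (n := n) {x | r x ≠ 0} (fun x => weight u x ^ tau * ζ x) ∧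
    ∫ x, weight u x ^ (tau + mu - lam) * inner ℝ (G x) (grad ζ x) +
        C / r x * weight u x ^ (tau + lam - mu) * ζ x ∂riemannianVolume n M =
      ∫ x, C / r x * weight u x ^ (lam - mu) * (weight u x ^ tau * ζ x) ∂riemannianVolume n M -
        affineLaplacianPairing u lam mu G (fun x => weight u x ^ tau * ζ x) := by
  refine ⟨⟨(contMDiff_weight_rpow hu tau).mul hζ.1, hζ.2.1.mul_left,
    tsupport_mul_subset_right.trans hζ.2.2⟩, ?_⟩
  have hcont := continuous_weight_rpow hu.continuous
  have i1 := hG.integrable_mul_inner_grad hγ hGγ isOpen_univ (hcont (tau + mu - lam)).continuousOn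
    (hcont (tau + mu - lam)).aestronglyMeasurable hζ.1 hζ.2.1 (subset_univ _)
  have hb : ContinuousOn (fun x => C / r x * weight u x ^ (tau + lam - mu)) {x | r x ≠ 0} :=
    (continuousOn_const.div hr.continuousOn fun _ hx => hx).mul (hcont _).continuousOn
  have i2 := integrable_mul_of_tsupport_subset (n := n) (isOpen_ne_zero hr) hb hζ.1.continuous
    hζ.2.1 hζ.2.2
  have hw : ∀ x, weight u x ^ (lam - mu) * weight u x ^ tau = weight u x ^ (tau + lam - mu) :=
    fun x => by rw [← Real.rpow_add (weight_pos u x)]; ring_nf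
  have h3 : ∀ x, C / r x * weight u x ^ (lam - mu) * (weight u x ^ tau * ζ x) =
      C / r x * weight u x ^ (tau + lam - mu) * ζ x := fun x => by rw [← hw x]; ring
  rw [affineLaplacianPairing_weight_rpow_mul hG hγ hGγ hu htau hζ.1 hζ.2.1, integral_add i1 i2]
  simp only [h3]
  ring

/-- The Hardy inequality with constant `κ = -s (α - 1 + C)`, where the sign `s` is that of the
differential inequality for `r`. -/
lemma hardy_of_weak_inequality (hG : IsWeakGradient r G) (hr : Continuous r)
    (hr0 : ∀ x, 0 ≤ r x) {u : M → ℝ} (hu : ContMDiff (𝓡 n) 𝓘(ℝ, ℝ) ∞ u) {lam mu : ℝ} (tau : ℝ)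
    (hGγ : ∀ᵐ x ∂riemannianVolume n M, ‖G x‖ = weight u x ^ (lam - mu))
    {α C s κ : ℝ} (hs : s ^ 2 = 1) (hκ : 0 < κ) (hκs : s * (α - 1 + C) = -κ)
    (hJ : ∀ ζ : M → ℝ, IsTestFunction (n := n) {x | r x ≠ 0} ζ → (∀ x, 0 ≤ ζ x) →
      0 ≤ s * ∫ x, weight u x ^ (tau + mu - lam) * inner ℝ (G x) (grad ζ x) +
        C / r x * weight u x ^ (tau + lam - mu) * ζ x ∂riemannianVolume n M)
    {φ : M → ℝ} (hφ : IsTestFunction (n := n) {x | r x ≠ 0} φ) :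
    (κ / 2) ^ 2 * ∫ x, r x ^ (α - 2) * φ x ^ 2 * weight u x ^ (tau + lam - mu)
        ∂riemannianVolume n M ≤
      ∫ x, r x ^ α * ‖affineGrad u lam mu (grad (n := n) φ) x‖ ^ 2 *
        weight u x ^ (tau + lam - mu) ∂riemannianVolume n M := by
  have hcont := continuous_weight_rpow hu.continuous
  have hΩ := isOpen_ne_zero hr
  have hrc := continuousOn_rpow_const_of_ne_zero hr
  have hb : ContinuousOn (fun x => C / r x * weight u x ^ (tau + lam - mu)) {x | r x ≠ 0} :=
    (continuousOn_const.div hr.continuousOn fun _ hx => hx).mul (hcont _).continuousOn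
  obtain ⟨hφ1, hφ2, hφ3⟩ := hφ
  have hψ : IsTestFunction (n := n) {x | r x ≠ 0} (fun x => φ x * φ x) :=
    ⟨hφ1.mul hφ1, hφ2.mul_left, tsupport_mul_subset_left.trans hφ3⟩
  -- The test function is `r ^ (α - 1) φ²`; differentiating the power produces the Hardy weight `r ^
  -- (α - 2)`.
  have h0 := testIntegrand_nonneg hG hr hr0 (hcont (lam - mu)) hGγ (hcont (tau + mu - lam)) hb s
    (α - 1) hJ hψ fun x => mul_self_nonneg _
  have iT := hG.integrable_testIntegrand hr (hcont (lam - mu)) hGγ (hcont (tau + mu - lam)) hb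
    (α - 1) hψ
  have hnorm : ∀ x, ‖affineGrad u lam mu (grad (n := n) φ) x‖ =
      weight u x ^ (mu - lam) * ‖grad (n := n) φ x‖ := fun x => by
    rw [affineGrad, norm_smul, Real.norm_of_nonneg (Real.rpow_nonneg (weight_pos u x).le _)]
  have iA : Integrable (fun x => r x ^ (α - 2) * φ x ^ 2 * weight u x ^ (tau + lam - mu))
      (riemannianVolume n M) := by
    refine (integrable_mul_of_tsupport_subset hΩ
      ((hrc (α - 2)).mul (hcont (tau + lam - mu)).continuousOn) hψ.1.continuous hψ.2.1
      hψ.2.2).congr (Eventually.of_forall fun x => ?_)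
    simp only [Pi.mul_apply]
    ring
  have iB : Integrable (fun x => r x ^ α * ‖affineGrad u lam mu (grad (n := n) φ) x‖ ^ 2 *
      weight u x ^ (tau + lam - mu)) (riemannianVolume n M) := by
    refine (integrable_mul_norm_grad_sq hΩ ((hrc α).mul (((hcont (mu - lam)).pow 2).mul
      (hcont (tau + lam - mu))).continuousOn) hφ1 hφ2 hφ3).congr (Eventually.of_forall fun x => ?_)
    simp only [Pi.mul_apply, Pi.pow_apply, hnorm]
    ring
  have hpt : ∀ᵐ x ∂riemannianVolume n M,
      s * testIntegrand r G (fun x => weight u x ^ (lam - mu))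
        (fun x => weight u x ^ (tau + mu - lam))
        (fun x => C / r x * weight u x ^ (tau + lam - mu)) (α - 1) (fun x => φ x * φ x) x ≤
      2 / κ * (r x ^ α * ‖affineGrad u lam mu (grad (n := n) φ) x‖ ^ 2 *
        weight u x ^ (tau + lam - mu)) -
      κ / 2 * (r x ^ (α - 2) * φ x ^ 2 * weight u x ^ (tau + lam - mu)) := by
    filter_upwards [hGγ] with x hx
    by_cases hxK : x ∈ tsupport φ
    · have hrx : 0 < r x := lt_of_le_of_ne (hr0 x) (Ne.symm (hφ3 hxK))
      have hφx := hφ1.mdifferentiable (by simp) x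
      have hV := weight_pos u x
      rw [hnorm, testIntegrand, grad_mul hφx hφx, inner_add_right, real_inner_smul_right]
      -- All powers are expressed through `r^(α-2)`, `V^(μ-λ)` and `V^(τ+λ-μ)`, so that only
      -- rational algebra in real variables remains.
      have e1 : r x ^ (α - 1) = r x ^ (α - 2) * r x := by
        rw [← Real.rpow_add_one hrx.ne']; ring_nf
      have e2 : r x ^ α = r x ^ (α - 2) * r x ^ 2 := by
        rw [← Real.rpow_natCast, ← Real.rpow_add hrx]; norm_num
      have e3 : α - 1 - 1 = α - 2 := by ring
      have e4 : weight u x ^ (tau + mu - lam) =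
          weight u x ^ (tau + lam - mu) * (weight u x ^ (mu - lam)) ^ 2 := by
        rw [← Real.rpow_natCast, ← Real.rpow_mul hV.le, ← Real.rpow_add hV]
        congr 1
        push_cast
        ring
      have e5 : weight u x ^ (lam - mu) = (weight u x ^ (mu - lam))⁻¹ := by
        rw [← Real.rpow_neg hV.le]; ring_nf
      have hin : |inner ℝ (G x) (grad (n := n) φ x)| ≤
          (weight u x ^ (mu - lam))⁻¹ * ‖grad (n := n) φ x‖ := by
        rw [← e5, ← hx]
        exact abs_real_inner_le_norm _ _
      rw [e1, e2, e3, e4, e5]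
      have hv : 0 < weight u x ^ (mu - lam) := Real.rpow_pos_of_pos hV _
      have hw : 0 < weight u x ^ (tau + lam - mu) := Real.rpow_pos_of_pos hV _
      have hP : 0 < r x ^ (α - 2) := Real.rpow_pos_of_pos hrx _
      generalize weight u x ^ (mu - lam) = v at *
      generalize weight u x ^ (tau + lam - mu) = w at *
      generalize r x ^ (α - 2) = P at *
      generalize (inner ℝ (G x) (grad (n := n) φ x) : ℝ) = i at *
      generalize ‖grad (n := n) φ x‖ = N at *
      generalize r x = t at *
      generalize φ x = y at *
      have hY : (s * t * v ^ 2 * i) ^ 2 ≤ t ^ 2 * v ^ 2 * N ^ 2 := by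
        have h1 : (v * i) ^ 2 ≤ N ^ 2 := by
          rw [← sq_abs (v * i), abs_mul, abs_of_pos hv]
          refine pow_le_pow_left₀ (by positivity) ?_ 2
          rw [inv_mul_eq_div, le_div_iff₀ hv] at hin
          linarith
        calc (s * t * v ^ 2 * i) ^ 2 = s ^ 2 * (t ^ 2 * v ^ 2 * (v * i) ^ 2) := by ring
          _ ≤ _ := by rw [hs, one_mul]; gcongr
      -- Young's inequality weighted by `κ / 2`, so that half of the available `κ y²` absorbs the
      -- cross term.
      have key : 2 * y * (s * t * v ^ 2 * i) ≤
          κ / 2 * y ^ 2 + 2 / κ * (t ^ 2 * v ^ 2 * N ^ 2) := by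
        have h1 : 2 * y * (s * t * v ^ 2 * i) ≤
            κ / 2 * y ^ 2 + 2 / κ * (s * t * v ^ 2 * i) ^ 2 := by
          have h2 : κ / 2 * y ^ 2 + 2 / κ * (s * t * v ^ 2 * i) ^ 2 -
              2 * y * (s * t * v ^ 2 * i) = κ / 2 * (y - 2 / κ * (s * t * v ^ 2 * i)) ^ 2 := by
            field_simp
            ring
          have h3 : 0 ≤ κ / 2 * (y - 2 / κ * (s * t * v ^ 2 * i)) ^ 2 := by positivity
          linarith
        have h4 : 2 / κ * (s * t * v ^ 2 * i) ^ 2 ≤ 2 / κ * (t ^ 2 * v ^ 2 * N ^ 2) :=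
          mul_le_mul_of_nonneg_left hY (by positivity)
        linarith
      have hL : s * (P * t * (w * v ^ 2 * (y * i + y * i) + C / t * w * (y * y)) +
          (α - 1) * P * (w * v ^ 2 * v⁻¹ ^ 2) * (y * y)) =
          P * w * (2 * y * (s * t * v ^ 2 * i) + s * (α - 1 + C) * y ^ 2) := by
        field_simp
        ring
      have hR : 2 / κ * (P * t ^ 2 * (v * N) ^ 2 * w) - κ / 2 * (P * y ^ 2 * w) =
          P * w * (2 / κ * (t ^ 2 * v ^ 2 * N ^ 2) - κ / 2 * y ^ 2) := by ring
      rw [hL, hR, hκs]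
      refine mul_le_mul_of_nonneg_left ?_ (by positivity)
      linarith
    · have hx' : x ∉ tsupport fun x => φ x * φ x := fun h => hxK (tsupport_mul_subset_left h)
      rw [hnorm, testIntegrand, grad_eq_zero_of_notMem_tsupport hx',
        grad_eq_zero_of_notMem_tsupport hxK, image_eq_zero_of_notMem_tsupport hxK]
      simp
  have hint := integral_mono_ae (iT.const_mul s) ((iB.const_mul (2 / κ)).sub (iA.const_mul (κ / 2)))
    hpt
  simp only [Pi.sub_apply] at hint
  rw [integral_const_mul, integral_sub (iB.const_mul (2 / κ)) (iA.const_mul (κ / 2)),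
    integral_const_mul, integral_const_mul] at hint
  have h1 := h0.trans hint
  generalize (∫ x, r x ^ α * ‖affineGrad u lam mu (grad (n := n) φ) x‖ ^ 2 *
        weight u x ^ (tau + lam - mu) ∂riemannianVolume n M) = I at *
  generalize (∫ x, r x ^ (α - 2) * φ x ^ 2 * weight u x ^ (tau + lam - mu)
        ∂riemannianVolume n M) = A at *
  -- Multiplying by `κ / 2` normalises the coefficient of the gradient integral to one.
  have h2 : κ / 2 * (2 / κ * I - κ / 2 * A) = I - (κ / 2) ^ 2 * A := by
    field_simp
  have h3 : 0 ≤ κ / 2 * (2 / κ * I - κ / 2 * A) := mul_nonneg (by positivity) h1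
  linarith

lemma norm_eq_weight_rpow_of_affineGrad {u : M → ℝ} {lam mu : ℝ}
    (h : ∀ᵐ x ∂riemannianVolume n M, ‖affineGrad u lam mu G x‖ = 1) :
    ∀ᵐ x ∂riemannianVolume n M, ‖G x‖ = weight u x ^ (lam - mu) := by
  filter_upwards [h] with x hx
  have hV := weight_pos u x
  rw [affineGrad, norm_smul, Real.norm_of_nonneg (Real.rpow_nonneg hV.le _)] at hx
  rw [← neg_sub mu lam, Real.rpow_neg hV.le]
  exact eq_inv_of_mul_eq_one_right hx

end Hardy

end AffineHardy

end

theorem mainTheorem1 {n : ℕ} {M : Type*} [TopologicalSpace M] [T2Space M]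
    [SecondCountableTopology M] [MeasurableSpace M] [BorelSpace M]
    [ChartedSpace (EuclideanSpace ℝ (Fin n)) M] [IsManifold (𝓡 n) ∞ M]
    [RiemannianBundle (fun x : M => TangentSpace (𝓡 n) x)]
    [IsContMDiffRiemannianBundle (𝓡 n) ∞ (EuclideanSpace ℝ (Fin n))
      (fun x : M => TangentSpace (𝓡 n) x)]
    (u : M → ℝ) (hu : ContMDiff (𝓡 n) 𝓘(ℝ, ℝ) ∞ u)
    (lam mu tau : ℝ) (htau : tau = (n + 1) * lam + mu)
    (ρ : M → ℝ) (hρ : Continuous ρ) (hρ0 : ∀ x, 0 ≤ ρ x)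
    (gradρ : ∀ x : M, TangentSpace (𝓡 n) x) (hgradρ : AffineHardy.IsWeakGradient ρ gradρ)
    (hnorm : ∀ᵐ x ∂AffineHardy.riemannianVolume n M,
      ‖AffineHardy.affineGrad u lam mu gradρ x‖ = 1)
    (α C : ℝ) (hC : 0 < C) :
    (AffineHardy.AffineLaplacianLE u lam mu gradρ {x | ρ x ≠ 0}
        (fun x => C / ρ x * AffineHardy.weight u x ^ (lam - mu)) →
      0 < 1 - α - C →
      ∀ φ : M → ℝ, AffineHardy.IsTestFunction (n := n) {x | ρ x ≠ 0} φ →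
        ∫ x, ρ x ^ α * ‖AffineHardy.affineGrad u lam mu (AffineHardy.grad (n := n) φ) x‖ ^ 2 *
            AffineHardy.weight u x ^ (tau + lam - mu) ∂AffineHardy.riemannianVolume n M ≥
          ((1 - α - C) / 2) ^ 2 *
            ∫ x, ρ x ^ (α - 2) * φ x ^ 2 *
              AffineHardy.weight u x ^ (tau + lam - mu) ∂AffineHardy.riemannianVolume n M) ∧
    (AffineHardy.AffineLaplacianGE u lam mu gradρ {x | ρ x ≠ 0}
        (fun x => C / ρ x * AffineHardy.weight u x ^ (lam - mu)) →
      0 < C + α - 1 →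
      ∀ φ : M → ℝ, AffineHardy.IsTestFunction (n := n) {x | ρ x ≠ 0} φ →
        ∫ x, ρ x ^ α * ‖AffineHardy.affineGrad u lam mu (AffineHardy.grad (n := n) φ) x‖ ^ 2 *
            AffineHardy.weight u x ^ (tau + lam - mu) ∂AffineHardy.riemannianVolume n M ≥
          ((α + C - 1) / 2) ^ 2 *
            ∫ x, ρ x ^ (α - 2) * φ x ^ 2 *
              AffineHardy.weight u x ^ (tau + lam - mu) ∂AffineHardy.riemannianVolume n M) := by
  have hGγ := AffineHardy.norm_eq_weight_rpow_of_affineGrad hnorm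
  have hγ := AffineHardy.continuous_weight_rpow hu.continuous (lam - mu)
  refine ⟨fun hL hκ φ hφ => ?_, fun hL hκ φ hφ => ?_⟩
  -- An upper bound on `Δ^D ρ` corresponds to `s = 1` and `κ = 1 - α - C`; the lower bound below
  -- corresponds to `s = -1` and `κ = C + α - 1`.
  · refine AffineHardy.hardy_of_weak_inequality hgradρ hρ hρ0 hu tau hGγ (s := 1) (one_pow 2) hκ
      (C := C) (by ring) (fun ζ hζ hζ0 => ?_) hφ
    obtain ⟨ht, h⟩ :=
      AffineHardy.integral_mul_inner_grad_add hgradρ hρ hγ hGγ hu htau C hζ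
    have := hL _ ht fun x =>
      mul_nonneg (Real.rpow_nonneg (AffineHardy.weight_pos u x).le _) (hζ0 x)
    rw [h]
    linarith
  · rw [show α + C - 1 = C + α - 1 by ring]
    refine AffineHardy.hardy_of_weak_inequality hgradρ hρ hρ0 hu tau hGγ (s := -1) (by norm_num)
      hκ (C := C) (by ring) (fun ζ hζ hζ0 => ?_) hφ
    obtain ⟨ht, h⟩ :=
      AffineHardy.integral_mul_inner_grad_add hgradρ hρ hγ hGγ hu htau C hζ
    have := hL _ ht fun x =>
      mul_nonneg (Real.rpow_nonneg (AffineHardy.weight_pos u x).le _) (hζ0 x)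
    rw [h]
    linarith
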